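/- Let $n\ge 2$ and let $\mathcal F\subseteq 2^{N}$, $N=\{1,\dots,n\}$, be the feasible sets (independent sets) of a matroid on the agents. In the permutation environment of $\mathcal F$, a permutation $\pi$ of $N$ is drawn uniformly at random, and then a (possibly random) set of $\mathcal F_\pi=\{\pi(S):S\in\mathcal F\}$ is served; $A\subseteq[0,1]^n$ denotes the set of vectors $x$ of service probabilities that arise in this way (the feasible allocations). Agents have values $v=(v_1,\dots,v_n)\in[0,\infty)^n$, and an agent who is served with probability $x_i$ and pays $p_i$ has utility $v_ix_i-p_i$. For a profile $v$, let $\mathrm{EFO}(v)$ be the supremum of $\sum_i p_i$ over all $x\in A$ and payments $p\ge 0$ that are envy free ($v_ix_i-p_i\ge v_ix_j-p_j$ for all $i,j$) and individually rational ($v_ix_i-p_i\ge 0$ for all $i$). Let $\mathrm{EFO}^{(2)}(v)=\mathrm{EFO}(v^{(2)})$, where $v^{(2)}$ is $v$ with the highest value lowered to the second highest one, i.e. $v^{(2)}=(v_2,v_2,v_3,\dots,v_n)$ if $v_1\ge v_2\ge\dots\ge v_n$. A mechanism consists of measurable maps $v\mapsto x(v)$, with values in the set of feasible allocations, and $v\mapsto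 p(v)\in[0,\infty)^n$ that are individually rational and incentive compatible, i.e. $v_ix_i(v)-p_i(v)\ge\max\{0,\;v_ix_i(z,v_{-i})-p_i(z,v_{-i})\}$ for all $v$, $i$ and $z\ge 0$. Its revenue on $v$ is $\sum_ip_i(v)$. The Bayesian optimal revenue for a distribution $F$ on $[0,\infty)$ is the supremum over all mechanisms of the expected revenue when the values are i.i.d. from $F$ (expectations and suprema may be $+\infty$). The distribution $F$ is $n$-tail regular if, in the $n$-agent $1$-unit environment (feasible sets: all $S$ with $|S|\le 1$), the Bayesian optimal revenue for $F$ is at most twice the expected revenue of the Vickrey (second-price) auction. **Theorem.** Let $F$ be an $n$-tail-regular distribution, let $\beta\ge 0$, and let a mechanism for the matroid permutation environment of $\mathcal F$ be a $\beta$-approximation to $\mathrm{EFO}^{(2)}$, i.e. $\mathrm{EFO}^{(2)}(v)\le\beta\sum_ip_i(v)$ for every profile $v$. Then its expected revenue on values drawn i.i.d. from $F$ is a $3\beta$-approximation to the Bayesian optimal revenue in this environment: $$\sup_{\text{mechanisms }(x',p')}\mathbf E_{v\sim F^n}\Big[\sum_ip_i'(v)\Big]\;\le\;3\beta\,\mathbf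 E_{v\sim F^n}\Big[\sum_ip_i(v)\Big].$$ -/

import Mathlib

open MeasureTheory
open scoped NNReal ENNReal

noncomputable section

namespace SingleDim

variable {n : ℕ}

/-! ### Environments and feasible allocations -/

/-- The set system of a matroid environment: the feasible sets are the independent sets of a
matroid on the agents (agents outside the ground set of the matroid can never be served, so
every set system on the agents that contains the empty set, is downward closed and has the
augmentation property is of this form). -/
def matroidFeasible (M : Matroid (Fin n)) : Set (Finset (Fin n)) :=
  {S | M.Indep (S : Set (Fin n))}

/-- The set system of the `1`-unit environment. -/
def oneUnitFeasible (n : ℕ) : Set (Finset (Fin n)) :=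
  {S | S.card ≤ 1}

/-- The characteristic vector of a set of served agents. -/
def served (S : Finset (Fin n)) : Fin n → ℝ :=
  fun i => if i ∈ S then 1 else 0

/-- The feasible allocations of a set system: vectors of service probabilities that arise
from a random choice of a feasible set. -/
def allocations (F : Set (Finset (Fin n))) : Set (Fin n → ℝ) :=
  convexHull ℝ (served '' F)

/-- The set system `F` after agent `i` has been renamed to `π i`. -/
def renamed (π : Equiv.Perm (Fin n)) (F : Set (Finset (Fin n))) : Set (Finset (Fin n)) :=
  (fun S => S.map π.toEmbedding) '' F

/-- The feasible allocations of the permutation environment of a set system: a permutation `π`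
is drawn uniformly at random, a feasible allocation `y π` of the renamed set system
is chosen, and the service probabilities are averaged over `π`. -/
def permAllocations (F : Set (Finset (Fin n))) : Set (Fin n → ℝ) :=
  {x | ∃ y : Equiv.Perm (Fin n) → Fin n → ℝ, (∀ π, y π ∈ allocations (renamed π F)) ∧
    ∀ i, x i = (∑ π, y π i) / (n.factorial : ℝ)}

/-! ### Envy-free outcomes and the envy-free benchmark -/

/-- No agent prefers the outcome of another agent to her own. -/
def EnvyFree (v : Fin n → ℝ≥0) (x : Fin n → ℝ) (p : Fin n → ℝ≥0) : Prop :=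
  ∀ i j, (v i : ℝ) * x j - p j ≤ v i * x i - p i

/-- Every agent has non-negative utility. -/
def IndividuallyRational (v : Fin n → ℝ≥0) (x : Fin n → ℝ) (p : Fin n → ℝ≥0) : Prop :=
  ∀ i, 0 ≤ (v i : ℝ) * x i - p i

/-- The optimal envy-free revenue on the profile `v` when the feasible allocations are `A`. -/
def EFO (A : Set (Fin n → ℝ)) (v : Fin n → ℝ≥0) : ℝ≥0∞ :=
  ⨆ (x : Fin n → ℝ) (p : Fin n → ℝ≥0) (_ : x ∈ A) (_ : EnvyFree v x p)
    (_ : IndividuallyRational v x p), ∑ i, (p i : ℝ≥0∞)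

/-- The highest value among the agents other than `i`. -/
def highestOther (v : Fin n → ℝ≥0) (i : Fin n) : ℝ≥0 :=
  (Finset.univ.erase i).sup v

/-- The profile `v` with the highest value lowered to the second highest one: a profile with
values `v₁ ≥ v₂ ≥ v₃ ≥ …` becomes `(v₂, v₂, v₃, …)`, and every other agent keeps her value. -/
def lowerHighest (v : Fin n → ℝ≥0) : Fin n → ℝ≥0 :=
  fun i => min (v i) (highestOther v i)

/-- The envy-free benchmark. -/
def EFO2 (A : Set (Fin n → ℝ)) (v : Fin n → ℝ≥0) : ℝ≥0∞ :=
  EFO A (lowerHighest v)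

/-! ### Incentive compatible mechanisms -/

/-- A mechanism: an allocation rule with values in the feasible allocations `A`, and a
non-negative payment rule, that are (measurable and) individually rational and (ex post)
incentive compatible. -/
structure Mechanism (A : Set (Fin n → ℝ)) where
  alloc : (Fin n → ℝ≥0) → Fin n → ℝ
  pay : (Fin n → ℝ≥0) → Fin n → ℝ≥0
  measurable_alloc : Measurable alloc
  measurable_pay : Measurable pay
  feasible : ∀ v, alloc v ∈ A
  individuallyRational : ∀ v, IndividuallyRational v (alloc v) (pay v)
  incentiveCompatible : ∀ (v : Fin n → ℝ≥0) (i : Fin n) (z : ℝ≥0),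
    (v i : ℝ) * alloc (Function.update v i z) i - pay (Function.update v i z) i
      ≤ v i * alloc v i - pay v i

/-- The revenue of a mechanism on the profile `v`. -/
def Mechanism.revenue {A : Set (Fin n → ℝ)} (m : Mechanism A) (v : Fin n → ℝ≥0) : ℝ≥0∞ :=
  ∑ i, (m.pay v i : ℝ≥0∞)

/-- The expected revenue of a mechanism when the values are drawn i.i.d. from `μ`. -/
def Mechanism.expectedRevenue {A : Set (Fin n → ℝ)} (m : Mechanism A) (μ : Measure ℝ≥0) :
    ℝ≥0∞ :=
  ∫⁻ v, m.revenue v ∂(Measure.pi fun _ : Fin n => μ)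

/-- The Bayesian optimal revenue for values that are i.i.d. from `μ`. -/
def optRevenue (A : Set (Fin n → ℝ)) (μ : Measure ℝ≥0) : ℝ≥0∞ :=
  ⨆ m : Mechanism A, m.expectedRevenue μ

/-- A mechanism is a `β`-approximation to the envy-free benchmark if it obtains at least a
`1 / β` fraction of it on every profile. -/
def ApproximatesEFO2 {A : Set (Fin n → ℝ)} (m : Mechanism A) (β : ℝ≥0) : Prop :=
  ∀ v, EFO2 A v ≤ β * m.revenue v

/-! ### The Vickrey auction and tail regularity -/

/-- Agent `i` wins the Vickrey auction: she has the highest value, where ties are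
broken in favour of the smaller index. -/
def WinsVickrey (v : Fin n → ℝ≥0) (i : Fin n) : Prop :=
  (∀ j, j < i → v j < v i) ∧ ∀ j, i < j → v j ≤ v i

lemma WinsVickrey.highestOther_le {v : Fin n → ℝ≥0} {i : Fin n} (h : WinsVickrey v i) :
    highestOther v i ≤ v i := by
  refine Finset.sup_le fun j hj => ?_
  rcases lt_or_gt_of_ne (Finset.ne_of_mem_erase hj) with hlt | hgt
  · exact (h.1 j hlt).le
  · exact h.2 j hgt

lemma le_highestOther_of_not_winsVickrey {v : Fin n → ℝ≥0} {i : Fin n}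
    (h : ¬ WinsVickrey v i) : v i ≤ highestOther v i := by
  have key : ∀ j, j ≠ i → v i ≤ v j → v i ≤ highestOther v i := fun j hj hle =>
    hle.trans (Finset.le_sup (f := v) (Finset.mem_erase.2 ⟨hj, Finset.mem_univ j⟩))
  by_contra hlt
  refine h ⟨fun j hj => ?_, fun j hj => ?_⟩
  · by_contra hc
    exact hlt (key j hj.ne (not_lt.1 hc))
  · by_contra hc
    exact hlt (key j hj.ne' (not_le.1 hc).le)

lemma WinsVickrey.unique {v : Fin n → ℝ≥0} {i j : Fin n} (hi : WinsVickrey v i)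
    (hj : WinsVickrey v j) : i = j := by
  rcases lt_trichotomy i j with h | h | h
  · exact absurd (hj.1 i h) (not_lt.2 (hi.2 j h))
  · exact h
  · exact absurd (hi.1 j h) (not_lt.2 (hj.2 i h))

lemma highestOther_update (v : Fin n → ℝ≥0) (i : Fin n) (z : ℝ≥0) :
    highestOther (Function.update v i z) i = highestOther v i :=
  Finset.sup_congr rfl fun _ hj => Function.update_of_ne (Finset.ne_of_mem_erase hj) _ _

lemma measurableSet_winsVickrey (i : Fin n) :
    MeasurableSet {v : Fin n → ℝ≥0 | WinsVickrey v i} := by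
  have : {v : Fin n → ℝ≥0 | WinsVickrey v i} =
      (⋂ j, ⋂ (_ : j < i), {v | v j < v i}) ∩ ⋂ j, ⋂ (_ : i < j), {v | v j ≤ v i} := by
    ext v
    simp [WinsVickrey]
  rw [this]
  exact (MeasurableSet.iInter fun j => MeasurableSet.iInter fun _ =>
      measurableSet_lt (measurable_pi_apply j) (measurable_pi_apply i)).inter
    (MeasurableSet.iInter fun j => MeasurableSet.iInter fun _ =>
      measurableSet_le (measurable_pi_apply j) (measurable_pi_apply i))

lemma measurable_highestOther (i : Fin n) :
    Measurable fun v : Fin n → ℝ≥0 => highestOther v i := by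
  have : (fun v : Fin n → ℝ≥0 => highestOther v i) =
      (Finset.univ.erase i).sup fun j (v : Fin n → ℝ≥0) => v j := by
    ext v
    simp [highestOther, Finset.sup_apply]
  rw [this]
  exact Finset.sup_induction measurable_const (fun _ hf _ hg => hf.sup hg)
    fun j _ => measurable_pi_apply j

open Classical in
/-- The Vickrey auction in the `1`-unit environment: the agent with the highest value wins and
pays the highest value of the other agents. -/
def vickrey (n : ℕ) : Mechanism (allocations (oneUnitFeasible n)) where
  alloc v i := if WinsVickrey v i then 1 else 0
  pay v i := if WinsVickrey v i then highestOther v i else 0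
  measurable_alloc := measurable_pi_iff.2 fun i =>
    Measurable.ite (measurableSet_winsVickrey i) measurable_const measurable_const
  measurable_pay := measurable_pi_iff.2 fun i =>
    Measurable.ite (measurableSet_winsVickrey i) (measurable_highestOther i) measurable_const
  feasible v := by
    refine subset_convexHull ℝ _ ⟨Finset.univ.filter (WinsVickrey v), ?_, ?_⟩
    · refine Finset.card_le_one.2 fun a ha b hb => ?_
      exact (Finset.mem_filter.1 ha).2.unique (Finset.mem_filter.1 hb).2
    · funext i
      simp [served]
  individuallyRational v i := by
    by_cases h : WinsVickrey v i
    · have := h.highestOther_le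
      simpa [h] using this
    · simp [h]
  incentiveCompatible v i z := by
    have h1 : WinsVickrey v i → (highestOther v i : ℝ) ≤ v i := fun h => by
      exact_mod_cast h.highestOther_le
    have h2 : ¬ WinsVickrey v i → (v i : ℝ) ≤ highestOther v i := fun h => by
      exact_mod_cast le_highestOther_of_not_winsVickrey h
    simp only [highestOther_update]
    by_cases h : WinsVickrey v i <;> by_cases h' : WinsVickrey (Function.update v i z) i <;>
      simp [h, h', h1, h2]

/-- A distribution is `n`-tail regular if, in the `n`-agent `1`-unit environment, the expected
revenue of the Vickrey auction is a `2`-approximation to the Bayesian optimal revenue. -/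
def TailRegular (n : ℕ) (μ : Measure ℝ≥0) : Prop :=
  optRevenue (allocations (oneUnitFeasible n)) μ ≤ 2 * (vickrey n).expectedRevenue μ

end SingleDim

end

open MeasureTheory
open scoped NNReal ENNReal

noncomputable section

namespace SingleDim

variable {n : ℕ}

/-! ### Payments for step allocation rules -/

/-! Everything rests on one inequality, `optRevenue_le_lintegral_EFO2`: for a tail-regular
distribution the Bayesian optimum is at most three times the expectation of `EFO2`. The pointwise
hypothesis on the given mechanism then finishes.

The optimum is approached by greedy mechanisms. Values are cut into cells of width ε up to a cap Nε,
and ironing attaches to each cell a virtual value y (`exists_virtualValue`). The revenue of a capped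
mechanism is at most its expected virtual surplus, up to an error of order nε. Greedy service by y
maximises virtual surplus on every profile. Its allocation is constant on level sets of y and
vanishes where y does, so its virtual surplus is at most its own revenue (`exists_gridMechanism`).
Greedy is optimal because averaging over permutations turns the matroid into a position environment
with decreasing weights `posWeight`: submodularity makes the weights decrease, and the rank function
bounds what the first k positions can receive.

The revenue of a greedy mechanism is then split at the second highest value. If the top agent is
charged as though her value were lowered to the second one, the payments are dominated by envy-free
payments on the lowered profile, hence by `EFO2` (`sum_gridMechanism_pay_le`). What she pays beyond
that, divided by the largest possible service probability q, is the revenue of a `1`-unit mechanism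
(`Mechanism.surplus`). By tail regularity its expectation is at most 2q times that of Vickrey, and q
times the Vickrey revenue is at most `EFO2` on every profile (`mul_vickrey_revenue_le`). Hence 1 + 2
= 3. Finally ε tends to 0 while the cap tends to infinity, and Fatou's lemma removes the cap without
any integrability assumption. -/

/-- The payment of an agent in cell `k` of the grid `0, ε, 2ε, …, Nε` when she is served with
probability `X j` in cell `j`. -/
def stepPay {N : ℕ} (ε : ℝ) (X : Fin (N + 1) → ℝ) (k : Fin (N + 1)) : ℝ :=
  ε * ∑ j, if j < k then X k - X j else 0

/-- The cell of the grid `0, ε, 2ε, …, Nε` that contains `v`. -/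
def cell (ε : ℝ) (N : ℕ) (v : ℝ≥0) : Fin (N + 1) :=
  ⟨min ⌊(v : ℝ) / ε⌋₊ N, Nat.lt_succ_of_le (min_le_right _ _)⟩

section StepPay

variable {N : ℕ} {ε : ℝ} {X X' : Fin (N + 1) → ℝ}

lemma cell_mono (hε : 0 < ε) : Monotone (cell ε N) := by
  intro v w h
  have h' : (v : ℝ) ≤ w := by exact_mod_cast h
  exact Fin.mk_le_mk.2 (min_le_min_right _ (Nat.floor_mono (by gcongr)))

lemma cell_mul_le (hε : 0 < ε) (v : ℝ≥0) : ((cell ε N v).val : ℝ) * ε ≤ v := by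
  have h1 : ((cell ε N v).val : ℝ) ≤ ⌊(v : ℝ) / ε⌋₊ := by
    exact_mod_cast min_le_left _ _
  have h2 : (⌊(v : ℝ) / ε⌋₊ : ℝ) ≤ v / ε := Nat.floor_le (by positivity)
  calc ((cell ε N v).val : ℝ) * ε ≤ v / ε * ε := by gcongr; exact h1.trans h2
    _ = v := by field_simp

/-- The top cell N is unbounded above, which is why it is excluded. -/
lemma lt_cell_add_one_mul (hε : 0 < ε) {v : ℝ≥0} (h : (cell ε N v).val < N) :
    (v : ℝ) < ((cell ε N v).val + 1) * ε := by
  have h1 : (cell ε N v).val = ⌊(v : ℝ) / ε⌋₊ := by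
    simp only [cell] at h ⊢
    omega
  have h2 := Nat.lt_floor_add_one ((v : ℝ) / ε)
  rw [h1, ← div_lt_iff₀ hε]
  exact h2

lemma measurable_cell (ε : ℝ) (N : ℕ) : Measurable (cell ε N) := by
  have : cell ε N = (fun k : ℕ => (⟨min k N, Nat.lt_succ_of_le (min_le_right _ _)⟩ : Fin (N + 1)))
      ∘ (fun v : ℝ≥0 => ⌊(v : ℝ) / ε⌋₊) := rfl
  rw [this]
  exact (measurable_of_countable _).comp
    (Nat.measurable_floor.comp (measurable_coe_nnreal_real.div_const _))

lemma stepPay_nonneg (hε : 0 ≤ ε) (hX : Monotone X) (k : Fin (N + 1)) : 0 ≤ stepPay ε X k := by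
  refine mul_nonneg hε (Finset.sum_nonneg fun j _ => ?_)
  split_ifs with h
  · exact sub_nonneg.2 (hX h.le)
  · rfl

lemma stepPay_mono_of_sub_le (hε : 0 ≤ ε) {k : Fin (N + 1)}
    (h : ∀ j < k, X k - X j ≤ X' k - X' j) : stepPay ε X k ≤ stepPay ε X' k := by
  refine mul_le_mul_of_nonneg_left (Finset.sum_le_sum fun j _ => ?_) hε
  split_ifs with hj
  · exact h j hj
  · rfl

lemma sum_ite_lt (k : Fin (N + 1)) (c : ℝ) : (∑ j, if j < k then c else 0) = k.val * c := by
  rw [← Finset.sum_filter, Finset.sum_const, nsmul_eq_mul, Finset.filter_gt_eq_Iio, Fin.card_Iio]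

lemma sum_ite_le (k : Fin (N + 1)) (c : ℝ) :
    (∑ j, if j ≤ k then c else 0) = (k.val + 1) * c := by
  rw [← Finset.sum_filter, Finset.sum_const, nsmul_eq_mul, Finset.filter_ge_eq_Iic, Fin.card_Iic]
  push_cast
  rfl

/-- By Abel summation `stepPay` prices the increment of X from cell j to cell j + 1 at (j + 1)ε.
Descending from k to l therefore saves at most kε per unit of service, so an agent in cell k, with
value at least kε, does not underreport. -/
lemma stepPay_sub_le (hε : 0 ≤ ε) (hX : Monotone X) {l k : Fin (N + 1)} (hlk : l ≤ k) :
    stepPay ε X k - stepPay ε X l ≤ k.val * ε * (X k - X l) := by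
  have : (∑ j, if j < k then X k - X j else 0) - (∑ j, if j < l then X l - X j else 0)
      ≤ k.val * (X k - X l) := by
    rw [← sum_ite_lt, ← Finset.sum_sub_distrib]
    refine Finset.sum_le_sum fun j _ => ?_
    by_cases h1 : j < l
    · simp [h1, h1.trans_le hlk]
    · by_cases h2 : j < k
      · have := hX (not_lt.1 h1)
        simp only [h1, h2, if_true, if_false]
        linarith
      · simp [h1, h2]
  calc stepPay ε X k - stepPay ε X l
      = ε * ((∑ j, if j < k then X k - X j else 0) - ∑ j, if j < l then X l - X j else 0) := by
        simp only [stepPay]; ring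
    _ ≤ ε * (k.val * (X k - X l)) := by gcongr
    _ = _ := by ring

/-- The other half of incentive compatibility: every increment above cell k costs at least (k + 1)ε
per unit, and values in a cell k below the top are smaller than that. -/
lemma le_stepPay_sub (hε : 0 ≤ ε) (hX : Monotone X) {k l : Fin (N + 1)} (hkl : k < l) :
    (k.val + 1) * ε * (X l - X k) ≤ stepPay ε X l - stepPay ε X k := by
  have : (k.val + 1) * (X l - X k) ≤
      (∑ j, if j < l then X l - X j else 0) - (∑ j, if j < k then X k - X j else 0) := by
    rw [← sum_ite_le, ← Finset.sum_sub_distrib]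
    refine Finset.sum_le_sum fun j _ => ?_
    rcases lt_trichotomy j k with h1 | rfl | h1
    · simp [h1, h1.trans hkl, h1.le]
    · simp [hkl]
    · by_cases h2 : j < l
      · have := hX h2.le
        simp [h2, h1.not_ge, h1.not_gt, this]
      · simp [h2, h1.not_ge, h1.not_gt]
  calc (k.val + 1) * ε * (X l - X k) = ε * ((k.val + 1) * (X l - X k)) := by ring
    _ ≤ ε * ((∑ j, if j < l then X l - X j else 0) - ∑ j, if j < k then X k - X j else 0) := by
        gcongr
    _ = _ := by simp only [stepPay]; ring

lemma stepPay_le (hε : 0 ≤ ε) (hX0 : ∀ k, 0 ≤ X k) (k : Fin (N + 1)) :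
    stepPay ε X k ≤ k.val * ε * X k := by
  have : (∑ j, if j < k then X k - X j else 0) ≤ k.val * X k := by
    rw [← sum_ite_lt]
    refine Finset.sum_le_sum fun j _ => ?_
    split_ifs
    · linarith [hX0 j]
    · rfl
  calc stepPay ε X k ≤ ε * (k.val * X k) := by unfold stepPay; gcongr
    _ = _ := by ring

lemma stepPay_le_mul (hε : 0 < ε) (hX0 : ∀ k, 0 ≤ X k) (v : ℝ≥0) :
    stepPay ε X (cell ε N v) ≤ v * X (cell ε N v) :=
  (stepPay_le hε.le hX0 _).trans (mul_le_mul_of_nonneg_right (cell_mul_le hε v) (hX0 _))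

/-- An agent with value `v` prefers the outcome of her own cell to those of the others. -/
lemma stepPay_incentive (hε : 0 < ε) (hX : Monotone X) (v : ℝ≥0) (l : Fin (N + 1)) :
    v * X l - stepPay ε X l ≤ v * X (cell ε N v) - stepPay ε X (cell ε N v) := by
  rcases le_or_gt l (cell ε N v) with h | h
  · have h1 := stepPay_sub_le hε.le hX h
    have h2 := mul_le_mul_of_nonneg_right (cell_mul_le (N := N) hε v) (sub_nonneg.2 (hX h))
    linarith
  · have h1 := le_stepPay_sub hε.le hX h
    have h3 : (cell ε N v).val < N := by
      have := l.2
      have h' : (cell ε N v).val < l.val := h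
      omega
    have h2 := mul_le_mul_of_nonneg_right (lt_cell_add_one_mul hε h3).le (sub_nonneg.2 (hX h.le))
    linarith

end StepPay

/-! ### Ironing -/

/-- The projection of a linear functional onto the cone of non-negative monotone functions
on a finite order. -/
lemma exists_ironing {ι : Type*} [Fintype ι] [LinearOrder ι] (L : (ι → ℝ) →ₗ[ℝ] ℝ) (a : ι → ℝ)
    (ha : ∀ k, 0 < a k) :
    ∃ y : ι → ℝ, Monotone y ∧ (∀ k, 0 ≤ y k) ∧
      (∀ X : ι → ℝ, Monotone X → (∀ k, 0 ≤ X k) → L X ≤ ∑ k, a k * y k * X k) ∧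
      ∀ X : ι → ℝ, Monotone X → (∀ k, 0 ≤ X k) → (∀ j k, y j = y k → X j = X k) →
        (∀ j, y j = 0 → X j = 0) → L X = ∑ k, a k * y k * X k := by
  -- Scaling coordinates by √a turns the inner product with weights a into the Euclidean one, and
  -- `d` undoes the scaling. The required y is the projection of the representative of L onto the
  -- cone of non-negative monotone functions.
  set s : ι → ℝ := fun k => Real.sqrt (a k) with hs
  have hs0 : ∀ k, 0 < s k := fun k => Real.sqrt_pos.2 (ha k)
  have hss : ∀ k, s k * s k = a k := fun k => Real.mul_self_sqrt (ha k).le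
  let d : EuclideanSpace ℝ ι → ι → ℝ := fun z k => z k / s k
  have hd : Continuous d := by fun_prop
  let K : Set (EuclideanSpace ℝ ι) := {z | Monotone (d z)} ∩ {z | ∀ k, 0 ≤ d z k}
  have hK0 : (0 : EuclideanSpace ℝ ι) ∈ K := by
    refine ⟨fun i j _ => ?_, fun k => ?_⟩ <;> simp [d]
  have hKcl : IsClosed K := by
    refine (isClosed_monotone.preimage hd).inter ?_
    have : {z : EuclideanSpace ℝ ι | ∀ k, 0 ≤ d z k} = ⋂ k, {z | 0 ≤ d z k} := by ext; simp
    rw [this]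
    exact isClosed_iInter fun k => isClosed_le continuous_const ((continuous_apply k).comp hd)
  have hKc : Convex ℝ K := by
    rintro x ⟨hx, hx0⟩ z ⟨hz, hz0⟩ p q hp hq _
    have hdd : d (p • x + q • z) = fun k => p * d x k + q * d z k := by
      funext k
      simp only [d, PiLp.add_apply, PiLp.smul_apply, smul_eq_mul]
      ring
    refine ⟨?_, ?_⟩
    · show Monotone (d _)
      rw [hdd]
      intro i j hij
      have h1 := mul_le_mul_of_nonneg_left (hx hij) hp
      have h2 := mul_le_mul_of_nonneg_left (hz hij) hq
      exact add_le_add h1 h2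
    · intro k
      rw [hdd]
      exact add_nonneg (mul_nonneg hp (hx0 k)) (mul_nonneg hq (hz0 k))
  let e : ι → ι → ℝ := fun k => Pi.single k 1
  have hL : ∀ X, L X = ∑ k, X k * L (e k) := fun X => by
    conv_lhs => rw [LinearMap.pi_apply_eq_sum_univ L X]
    refine Finset.sum_congr rfl fun k _ => ?_
    rw [smul_eq_mul]
    congr 2
    funext j
    simp [e, Pi.single_apply, eq_comm]
  let u : EuclideanSpace ℝ ι := WithLp.toLp 2 fun k => L (e k) / s k
  obtain ⟨z, hzK, hz⟩ := exists_norm_eq_iInf_of_complete_convex ⟨0, hK0⟩ hKcl.isComplete hKc u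
  rw [norm_eq_iInf_iff_real_inner_le_zero hKc hzK] at hz
  have key : ∀ y' : ι → ℝ, Monotone y' → (∀ k, 0 ≤ y' k) →
      ∑ k, (L (e k) - a k * d z k) * (y' k - d z k) ≤ 0 := by
    intro y' hm h0
    have hdd : d (WithLp.toLp 2 fun k => s k * y' k) = y' := by
      funext k
      simp only [d]
      have := (hs0 k).ne'
      field_simp
    have h1 := hz (WithLp.toLp 2 fun k => s k * y' k)
      ⟨by show Monotone (d _); rw [hdd]; exact hm, by
        show ∀ k, 0 ≤ d _ k
        rw [hdd]; exact h0⟩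
    refine le_trans (le_of_eq ?_) h1
    rw [PiLp.inner_apply]
    refine Finset.sum_congr rfl fun k _ => ?_
    have := (hs0 k).ne'
    simp only [u, d, PiLp.sub_apply, RCLike.inner_apply, conj_trivial, ← hss]
    field_simp
  refine ⟨d z, hzK.1, hzK.2, fun X hX hX0 => ?_, fun X hX hX0 hXc hXz => ?_⟩
  -- The cone is closed under addition, so the variational inequality may be tested at y + X.
  · have h1 := key (fun k => d z k + X k) (hzK.1.add hX) fun k => add_nonneg (hzK.2 k) (hX0 k)
    rw [hL, ← sub_nonpos, ← Finset.sum_sub_distrib]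
    refine le_trans (le_of_eq (Finset.sum_congr rfl fun k _ => ?_)) h1
    ring
  · refine le_antisymm ?_ ?_
    · have h1 := key (fun k => d z k + X k) (hzK.1.add hX) fun k => add_nonneg (hzK.2 k) (hX0 k)
      rw [hL, ← sub_nonpos, ← Finset.sum_sub_distrib]
      refine le_trans (le_of_eq (Finset.sum_congr rfl fun k _ => ?_)) h1
      ring
    -- For the reverse inequality the test point is y - rX with r > 0 small. Membership in the cone
    -- amounts to finitely many conditions r * c ≤ g with g ≥ 0. Where g = 0, the assumptions on
    -- level sets and zeros of y force c = 0.
    · have hev : ∀ c g : ℝ, 0 ≤ g → (g = 0 → c = 0) →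
          ∀ᶠ r in nhdsWithin (0 : ℝ) (Set.Ioi 0), r * c ≤ g := by
        intro c g hg hgc
        rcases hg.eq_or_lt with h | h
        · simp [hgc h.symm, ← h]
        · have : Filter.Tendsto (fun r : ℝ => r * c) (nhdsWithin 0 (Set.Ioi 0)) (nhds 0) := by
            have : Filter.Tendsto (fun r : ℝ => r * c) (nhds 0) (nhds (0 * c)) :=
              (continuous_id.mul continuous_const).tendsto 0
            rw [zero_mul] at this
            exact this.mono_left nhdsWithin_le_nhds
          exact (this.eventually (gt_mem_nhds h)).mono fun _ => le_of_lt
      have h1 : ∀ᶠ r in nhdsWithin (0 : ℝ) (Set.Ioi 0), ∀ i j : ι, i ≤ j →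
          r * (X j - X i) ≤ d z j - d z i := by
        refine Filter.eventually_all.2 fun i => Filter.eventually_all.2 fun j => ?_
        by_cases hij : i ≤ j
        · refine (hev (X j - X i) (d z j - d z i) (sub_nonneg.2 (hzK.1 hij)) fun h => ?_).mono
            fun r hr _ => hr
          exact sub_eq_zero.2 (hXc _ _ (sub_eq_zero.1 h))
        · exact Filter.Eventually.of_forall fun r h => absurd h hij
      have h2 : ∀ᶠ r in nhdsWithin (0 : ℝ) (Set.Ioi 0), ∀ i : ι, r * X i ≤ d z i :=
        Filter.eventually_all.2 fun i => hev _ _ (hzK.2 i) (hXz i)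
      obtain ⟨r, ⟨hr1, hr2⟩, hr⟩ := ((h1.and h2).and self_mem_nhdsWithin).exists
      have h3 := key (fun k => d z k - r * X k)
        (fun i j hij => by have := hr1 i j hij; simp only; linarith)
        fun k => sub_nonneg.2 (hr2 k)
      rw [hL, ← sub_nonneg, ← Finset.sum_sub_distrib]
      have h4 : ∑ k, (L (e k) - a k * d z k) * (d z k - r * X k - d z k)
          = - (r * ∑ k, (X k * L (e k) - a k * d z k * X k)) := by
        rw [Finset.mul_sum, ← Finset.sum_neg_distrib]
        exact Finset.sum_congr rfl fun k _ => by ring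
      rw [h4] at h3
      have hr' : (0 : ℝ) < r := hr
      by_contra hneg
      have := mul_neg_of_pos_of_neg hr' (not_le.1 hneg)
      linarith

/-! ### Ironed virtual values of a distribution -/

section VirtualValue

variable {N : ℕ} {ε : ℝ}

/-- The grid point `jε`. -/
def gridPoint (ε : ℝ) (j : ℕ) : ℝ≥0 := Real.toNNReal (j * ε)

lemma coe_gridPoint (hε : 0 < ε) (j : ℕ) : (gridPoint ε j : ℝ) = j * ε :=
  Real.coe_toNNReal _ (by positivity)

lemma gridPoint_cell_le (hε : 0 < ε) (v : ℝ≥0) : gridPoint ε (cell ε N v).val ≤ v := by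
  rw [← NNReal.coe_le_coe, coe_gridPoint hε]
  exact cell_mul_le hε v

lemma le_gridPoint_cell (hε : 0 < ε) {v : ℝ≥0} (h : (cell ε N v).val < N) :
    v ≤ gridPoint ε ((cell ε N v).val + 1) := by
  rw [← NNReal.coe_le_coe, coe_gridPoint hε]
  push_cast
  exact (lt_cell_add_one_mul hε h).le

/-- The outcomes `x`, `p` offered to a single agent are incentive compatible and individually
rational, and truthful reports above `T` do not matter. -/
structure CappedMenu (x p : ℝ≥0 → ℝ) (T : ℝ≥0) : Prop where
  measurable_x : Measurable x
  measurable_p : Measurable p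
  ic : ∀ v z : ℝ≥0, (v : ℝ) * x z - p z ≤ v * x v - p v
  ir : ∀ v : ℝ≥0, 0 ≤ (v : ℝ) * x v - p v
  x_nonneg : ∀ v, 0 ≤ x v
  x_le_one : ∀ v, x v ≤ 1
  p_nonneg : ∀ v, 0 ≤ p v
  x_cap : ∀ v, T ≤ v → x v = x T
  p_cap : ∀ v, T ≤ v → p v = p T

/-! ### Payment bounds for a single agent. -/

namespace CappedMenu

variable {x p : ℝ≥0 → ℝ} {T : ℝ≥0}

lemma monotone (h : CappedMenu x p T) : Monotone x := by
  intro z v hzv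
  rcases hzv.eq_or_lt with rfl | hlt
  · rfl
  have h1 := h.ic v z
  have h2 := h.ic z v
  have h3 : (0 : ℝ) < v - z := sub_pos.2 (by exact_mod_cast hlt)
  by_contra hc
  have := mul_pos h3 (sub_pos.2 (not_le.1 hc))
  linarith

/-- The allocation is a subgradient of the utility; summed over grid points, this gives the lower
Riemann sum in `utility_gridPoint`. -/
lemma utility_growth (h : CappedMenu x p T) (v w : ℝ≥0) :
    (v * x v - p v) + (w - v) * x v ≤ w * x w - p w := by
  have := h.ic w v
  linarith

lemma utility_gridPoint (h : CappedMenu x p T) (hε : 0 < ε) (k : ℕ) :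
    ε * ∑ j ∈ Finset.range k, x (gridPoint ε j) ≤
      (gridPoint ε k : ℝ) * x (gridPoint ε k) - p (gridPoint ε k) := by
  induction k with
  | zero => simpa using h.ir _
  | succ k ih =>
    have h1 := h.utility_growth (gridPoint ε k) (gridPoint ε (k + 1))
    have h2 : (gridPoint ε (k + 1) : ℝ) - gridPoint ε k = ε := by
      rw [coe_gridPoint hε, coe_gridPoint hε]
      push_cast
      ring
    rw [h2] at h1
    rw [Finset.sum_range_succ, mul_add]
    linarith

/-- A payment is value received minus utility. The value is rounded up to the next grid point and
the utility is bounded below by its value at the cell's left end. In the top cell the cap replaces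
the missing upper bound on v. -/
lemma p_le (h : CappedMenu x p (gridPoint ε N)) (hε : 0 < ε) (v : ℝ≥0) :
    p v ≤ ((cell ε N v).val + 1) * ε * x v
      - ε * ∑ j ∈ Finset.range (cell ε N v).val, x (gridPoint ε j) := by
  have h1 := h.utility_gridPoint hε (cell ε N v).val
  have h0 := gridPoint_cell_le (N := N) hε v
  rcases Nat.lt_or_ge (cell ε N v).val N with hlt | hge
  · have h2 := h.utility_growth (gridPoint ε (cell ε N v).val) v
    have h3 := mul_nonneg (sub_nonneg.2 (NNReal.coe_le_coe.2 h0))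
      (h.x_nonneg (gridPoint ε (cell ε N v).val))
    have h4 := mul_le_mul_of_nonneg_right (lt_cell_add_one_mul hε hlt).le (h.x_nonneg v)
    linarith
  · have hN : (cell ε N v).val = N := le_antisymm (Nat.le_of_lt_succ (cell ε N v).2) hge
    rw [hN] at h0 h1 ⊢
    rw [h.x_cap v h0, h.p_cap v h0]
    rw [coe_gridPoint hε] at h1
    have := mul_nonneg hε.le (h.x_nonneg (gridPoint ε N))
    linarith

end CappedMenu

/-! ### Discretisation: expectations over cells and cell averages. -/

lemma measurableSet_cell (k : Fin (N + 1)) : MeasurableSet {v | cell ε N v = k} :=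
  measurable_cell ε N (measurableSet_singleton k)

lemma integral_comp_cell_mul (μ : Measure ℝ≥0) [IsProbabilityMeasure μ] (g : Fin (N + 1) → ℝ)
    {x : ℝ≥0 → ℝ} (hx : Integrable x μ) :
    ∫ v, g (cell ε N v) * x v ∂μ = ∑ k, g k * ∫ v in {v | cell ε N v = k}, x v ∂μ := by
  have h1 : ∀ v, g (cell ε N v) * x v =
      ∑ k, g k * Set.indicator {v | cell ε N v = k} x v := by
    intro v
    rw [Finset.sum_eq_single (cell ε N v)]
    · simp
    · intro k _ hk
      simp [Set.indicator, hk.symm]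
    · simp
  simp_rw [h1]
  rw [integral_finsetSum _ fun k _ =>
    (hx.indicator (measurableSet_cell k)).const_mul _]
  refine Finset.sum_congr rfl fun k _ => ?_
  rw [integral_const_mul, integral_indicator (measurableSet_cell k)]

lemma integral_comp_cell (μ : Measure ℝ≥0) [IsProbabilityMeasure μ] (g : Fin (N + 1) → ℝ) :
    ∫ v, g (cell ε N v) ∂μ = ∑ k, μ.real {v | cell ε N v = k} * g k := by
  have := integral_comp_cell_mul (ε := ε) μ g (x := fun _ => 1) (integrable_const _)
  simp only [mul_one, setIntegral_const, smul_eq_mul] at this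
  rw [this]
  exact Finset.sum_congr rfl fun k _ => mul_comm _ _

lemma sum_ite_lt_eq_range (k : Fin (N + 1)) (h : ℕ → ℝ) :
    (∑ j : Fin (N + 1), if j < k then h j.val else 0) = ∑ j ∈ Finset.range k.val, h j := by
  have h1 := Fin.sum_univ_eq_sum_range (fun j => if j < k.val then h j else 0) (N + 1)
  simp only [← Fin.lt_def] at h1
  rw [h1, ← Finset.sum_filter]
  refine Finset.sum_congr ?_ fun _ _ => rfl
  ext j
  simp only [Finset.mem_filter, Finset.mem_range]
  have := k.2
  omega

/-- The expectation of `stepPay` as a linear functional. -/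
def expectedStepPay (μ : Measure ℝ≥0) (ε : ℝ) (N : ℕ) : (Fin (N + 1) → ℝ) →ₗ[ℝ] ℝ where
  toFun X := ∑ k, μ.real {v | cell ε N v = k} * stepPay ε X k
  map_add' X Y := by
    rw [← Finset.sum_add_distrib]
    refine Finset.sum_congr rfl fun k _ => ?_
    simp only [stepPay, ← mul_add, ← Finset.sum_add_distrib]
    congr 2
    refine Finset.sum_congr rfl fun j _ => ?_
    simp only [Pi.add_apply]
    split_ifs <;> ring
  map_smul' c X := by
    simp only [stepPay, Pi.smul_apply, smul_eq_mul, RingHom.id_apply, Finset.mul_sum]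
    refine Finset.sum_congr rfl fun k _ => Finset.sum_congr rfl fun j _ => ?_
    split_ifs <;> ring

lemma expectedStepPay_eq (μ : Measure ℝ≥0) [IsProbabilityMeasure μ] (X : Fin (N + 1) → ℝ) :
    expectedStepPay μ ε N X = ∫ v, stepPay ε X (cell ε N v) ∂μ :=
  (integral_comp_cell μ (stepPay ε X)).symm

/-- The average of `x` over a cell. -/
def cellAverage (μ : Measure ℝ≥0) (ε : ℝ) (N : ℕ) (x : ℝ≥0 → ℝ) (k : Fin (N + 1)) : ℝ :=
  -- On a null cell a value of x inside that cell keeps the averages monotone and within the bounds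
  -- of x.
  if μ.real {v | cell ε N v = k} = 0 then x (gridPoint ε k.val)
  else (∫ v in {v | cell ε N v = k}, x v ∂μ) / μ.real {v | cell ε N v = k}

lemma cell_gridPoint (hε : 0 < ε) (k : Fin (N + 1)) : cell ε N (gridPoint ε k.val) = k := by
  refine Fin.ext ?_
  simp only [cell, coe_gridPoint hε]
  rw [mul_div_cancel_right₀ _ hε.ne', Nat.floor_natCast]
  exact min_eq_left (Nat.le_of_lt_succ k.2)

section

variable (μ : Measure ℝ≥0) [IsProbabilityMeasure μ] {x p : ℝ≥0 → ℝ}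

lemma mul_cellAverage (x : ℝ≥0 → ℝ) (k : Fin (N + 1)) :
    μ.real {v | cell ε N v = k} * cellAverage μ ε N x k = ∫ v in {v | cell ε N v = k}, x v ∂μ := by
  unfold cellAverage
  split_ifs with h
  · rw [h, zero_mul, Measure.restrict_eq_zero.2 ((measureReal_eq_zero_iff).1 h)]
    simp
  · field_simp

lemma cellAverage_mem_Icc (hε : 0 < ε) (hx : Integrable x μ) {k : Fin (N + 1)} {a b : ℝ}
    (ha : ∀ v, cell ε N v = k → a ≤ x v) (hb : ∀ v, cell ε N v = k → x v ≤ b) :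
    a ≤ cellAverage μ ε N x k ∧ cellAverage μ ε N x k ≤ b := by
  unfold cellAverage
  split_ifs with h
  · exact ⟨ha _ (cell_gridPoint hε k), hb _ (cell_gridPoint hε k)⟩
  · have hpos : 0 < μ.real {v | cell ε N v = k} := lt_of_le_of_ne measureReal_nonneg (Ne.symm h)
    rw [le_div_iff₀ hpos, div_le_iff₀ hpos]
    have hc : ∀ c : ℝ, ∫ _ in {v | cell ε N v = k}, c ∂μ = c * μ.real {v | cell ε N v = k} := by
      intro c
      rw [setIntegral_const, smul_eq_mul, mul_comm]
    rw [← hc a, ← hc b]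
    exact ⟨setIntegral_mono_on (integrable_const _).integrableOn hx.integrableOn
        (measurableSet_cell k) ha,
      setIntegral_mono_on hx.integrableOn (integrable_const _).integrableOn
        (measurableSet_cell k) hb⟩

lemma CappedMenu.integrable_x {T : ℝ≥0} (h : CappedMenu x p T) : Integrable x μ :=
  Integrable.of_bound h.measurable_x.aestronglyMeasurable 1
    (Filter.Eventually.of_forall fun v => by
      rw [Real.norm_of_nonneg (h.x_nonneg v)]
      exact h.x_le_one v)

lemma integrable_comp_cell (g : Fin (N + 1) → ℝ) : Integrable (fun v => g (cell ε N v)) μ :=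
  Integrable.of_bound ((measurable_of_countable g).comp
    (measurable_cell ε N)).aestronglyMeasurable (∑ k, ‖g k‖)
    (Filter.Eventually.of_forall fun v =>
      Finset.single_le_sum (f := fun k => ‖g k‖) (fun _ _ => norm_nonneg _)
        (Finset.mem_univ (cell ε N v)))

lemma CappedMenu.integrable_p {x p : ℝ≥0 → ℝ} {T : ℝ≥0} (h : CappedMenu x p T) :
    Integrable p μ := by
  have hT : ∀ v, v ≤ T → p v ≤ T := fun v hv => by
    have h1 := h.ir v
    have h2 := mul_le_mul_of_nonneg_left (h.x_le_one v) v.coe_nonneg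
    have h3 : (v : ℝ) ≤ T := by exact_mod_cast hv
    linarith
  refine Integrable.of_bound h.measurable_p.aestronglyMeasurable T
    (Filter.Eventually.of_forall fun v => ?_)
  rw [Real.norm_of_nonneg (h.p_nonneg v)]
  rcases le_total v T with hv | hv
  · exact hT v hv
  · rw [h.p_cap v hv]
    exact hT T le_rfl

/-- Replacing x by its cell averages costs 2ε: one ε from rounding the value up in `p_le`, another
because an average over a cell is bounded by x at the right end, which shifts the Riemann sum by one
term. -/
lemma CappedMenu.integral_p_le (hε : 0 < ε) (h : CappedMenu x p (gridPoint ε N)) :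
    Monotone (cellAverage μ ε N x) ∧ (∀ k, 0 ≤ cellAverage μ ε N x k) ∧
      (∀ k, cellAverage μ ε N x k ≤ 1) ∧
      ∫ v, p v ∂μ ≤ 2 * ε + expectedStepPay μ ε N (cellAverage μ ε N x) := by
  have hxi := h.integrable_x μ
  have hlo : ∀ k : Fin (N + 1), x (gridPoint ε k.val) ≤ cellAverage μ ε N x k := fun k =>
    (cellAverage_mem_Icc μ hε hxi (b := 1) (fun v hv => h.monotone (by
      rw [← hv]; exact gridPoint_cell_le hε v)) fun v _ => h.x_le_one v).1
  have hhi : ∀ k : Fin (N + 1), k.val < N →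
      cellAverage μ ε N x k ≤ x (gridPoint ε (k.val + 1)) := fun k hk =>
    (cellAverage_mem_Icc μ hε hxi (a := 0) (fun v _ => h.x_nonneg v)
      fun v hv => h.monotone (by
        rw [← hv] at hk ⊢; exact le_gridPoint_cell hε hk)).2
  have h1 : ∀ k, cellAverage μ ε N x k ≤ 1 := fun k =>
    (cellAverage_mem_Icc μ hε hxi (a := 0) (fun v _ => h.x_nonneg v)
      fun v _ => h.x_le_one v).2
  have hgm : Monotone (gridPoint ε) := fun i j hij => by
    rw [← NNReal.coe_le_coe, coe_gridPoint hε, coe_gridPoint hε]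
    gcongr
  refine ⟨?_, fun k => (h.x_nonneg _).trans (hlo k), h1, ?_⟩
  · intro j k hjk
    rcases hjk.eq_or_lt with rfl | hlt
    · rfl
    have hlt' : j.val < k.val := hlt
    have := k.2
    exact (hhi j (by omega)).trans ((h.monotone (hgm hlt')).trans (hlo k))
  set xb := cellAverage μ ε N x
  have hsum : ∀ k : Fin (N + 1), (∑ j, if j < k then xb j else 0) ≤
      ∑ j ∈ Finset.range k.val, x (gridPoint ε j) + 1 := by
    intro k
    calc (∑ j, if j < k then xb j else 0)
        ≤ ∑ j : Fin (N + 1), if j < k then x (gridPoint ε (j.val + 1)) else 0 := by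
          refine Finset.sum_le_sum fun j _ => ?_
          split_ifs with hj
          · have : j.val < k.val := hj
            have := k.2
            exact hhi j (by omega)
          · rfl
      _ = ∑ j ∈ Finset.range k.val, x (gridPoint ε (j + 1)) :=
          sum_ite_lt_eq_range k fun j => x (gridPoint ε (j + 1))
      _ = ∑ j ∈ Finset.range (k.val + 1), x (gridPoint ε j) - x (gridPoint ε 0) := by
          rw [Finset.sum_range_succ']; ring
      _ ≤ _ := by
          rw [Finset.sum_range_succ]
          linarith [h.x_le_one (gridPoint ε k.val), h.x_nonneg (gridPoint ε 0)]
  have hp : ∀ v, p v ≤ 2 * ε + (((cell ε N v).val : ℝ) * ε) * x v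
      - ε * ∑ j, if j < cell ε N v then xb j else 0 := by
    intro v
    have h2 := h.p_le hε v
    have h3 := mul_le_mul_of_nonneg_left (hsum (cell ε N v)) hε.le
    have h4 := mul_le_mul_of_nonneg_left (h.x_le_one v) hε.le
    linarith
  have hkx : Integrable (fun v => (((cell ε N v).val : ℝ) * ε) * x v) μ :=
    hxi.bdd_mul (c := N * ε) (integrable_comp_cell μ fun k => (k.val : ℝ) * ε).aestronglyMeasurable
      (Filter.Eventually.of_forall fun v => by
        rw [Real.norm_of_nonneg (by positivity)]
        have h6 : ((cell ε N v).val : ℝ) ≤ N := by exact_mod_cast Nat.le_of_lt_succ (cell ε N v).2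
        gcongr)
  have hs := integrable_comp_cell μ (ε := ε) fun k => ε * ∑ j, if j < k then xb j else 0
  calc ∫ v, p v ∂μ ≤ ∫ v, (2 * ε + (((cell ε N v).val : ℝ) * ε) * x v
        - ε * ∑ j, if j < cell ε N v then xb j else 0) ∂μ :=
        integral_mono (h.integrable_p μ) (((integrable_const _).add hkx).sub hs) hp
    _ = 2 * ε + ∫ v, (((cell ε N v).val : ℝ) * ε) * x v ∂μ
        - ∫ v, ε * ∑ j, (if j < cell ε N v then xb j else 0) ∂μ := by
        have h7 : ∫ v, (2 * ε + (((cell ε N v).val : ℝ) * ε) * x v) ∂μ =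
            2 * ε + ∫ v, (((cell ε N v).val : ℝ) * ε) * x v ∂μ := by
          rw [integral_add (integrable_const _) hkx]
          simp
        rw [← h7]
        exact integral_sub ((integrable_const _).add hkx) hs
    _ = _ := by
        rw [integral_comp_cell_mul μ (fun k => (k.val : ℝ) * ε) hxi,
          integral_comp_cell μ fun k => ε * ∑ j, (if j < k then xb j else 0), add_sub_assoc,
          ← Finset.sum_sub_distrib]
        congr 1
        refine Finset.sum_congr rfl fun k _ => ?_
        rw [← mul_cellAverage, stepPay]
        have : (∑ j, if j < k then xb k - xb j else 0) =
            k.val * xb k - ∑ j, if j < k then xb j else 0 := by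
          rw [← sum_ite_lt, ← Finset.sum_sub_distrib]
          refine Finset.sum_congr rfl fun j _ => ?_
          split_ifs <;> ring
        rw [this]
        ring

/-- Approximate ironed virtual values: they bound the revenue from a single agent, and the
bound is attained by allocation rules that are constant on their level sets. -/
lemma exists_virtualValue (hε : 0 < ε) (N : ℕ) :
    ∃ y : Fin (N + 1) → ℝ, Monotone y ∧ (∀ k, 0 ≤ y k) ∧
      (∀ x p : ℝ≥0 → ℝ, CappedMenu x p (gridPoint ε N) →
        ∫ v, p v ∂μ ≤ 3 * ε + ∫ v, y (cell ε N v) * x v ∂μ) ∧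
      ∀ X : Fin (N + 1) → ℝ, Monotone X → (∀ k, 0 ≤ X k) → (∀ j k, y j = y k → X j = X k) →
        (∀ j, y j = 0 → X j = 0) →
        ∫ v, y (cell ε N v) * X (cell ε N v) ∂μ ≤ ∫ v, stepPay ε X (cell ε N v) ∂μ := by
  set T : ℝ := N * ε with hT
  have hT0 : 0 ≤ T := by positivity
  -- Ironing needs positive weights, while cells may be null. The extra weight is chosen so that an
  -- error δT in each of the N + 1 cells adds up to at most ε.
  set δ : ℝ := ε / ((N + 1) * (T + 1)) with hδ
  have hδ0 : 0 < δ := by positivity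
  set f : Fin (N + 1) → ℝ := fun k => μ.real {v | cell ε N v = k} with hf
  have hf0 : ∀ k, 0 ≤ f k := fun k => measureReal_nonneg
  obtain ⟨y, hy, hy0, hle, heq⟩ := exists_ironing (expectedStepPay μ ε N) (fun k => f k + δ)
    fun k => add_pos_of_nonneg_of_pos (hf0 k) hδ0
  -- The excess (y - T)⁺ is constant on level sets of y and zero where y is, so it is an admissible
  -- test function in `heq`. As step payments are at most T per unit of service, the excess must
  -- vanish.
  have hyT : ∀ k, y k ≤ T := by
    set X : Fin (N + 1) → ℝ := fun k => max (y k - T) 0 with hX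
    have hX0 : ∀ k, 0 ≤ X k := fun k => le_max_right _ _
    have h1 := heq X (fun i j hij => max_le_max (sub_le_sub_right (hy hij) T) le_rfl) hX0
      (fun j k h => by simp only [hX, h]) fun j h => by simp [hX, h, hT0]
    have h2 : expectedStepPay μ ε N X ≤ ∑ k, (f k + δ) * T * X k := by
      show ∑ k, f k * stepPay ε X k ≤ _
      refine Finset.sum_le_sum fun k _ => ?_
      have hk : (k.val : ℝ) ≤ N := by exact_mod_cast Nat.le_of_lt_succ k.2
      calc f k * stepPay ε X k ≤ f k * (k.val * ε * X k) :=
            mul_le_mul_of_nonneg_left (stepPay_le hε.le hX0 k) (hf0 k)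
        _ ≤ (f k + δ) * (T * X k) := by
            have := hX0 k
            have := hf0 k
            rw [hT]
            gcongr
            linarith
        _ = _ := by ring
    have h3 : ∑ k, (f k + δ) * ((y k - T) * X k) ≤ 0 := by
      rw [h1, ← sub_nonpos, ← Finset.sum_sub_distrib] at h2
      refine le_trans (le_of_eq (Finset.sum_congr rfl fun k _ => ?_)) h2
      ring
    have h4 : ∀ k, 0 ≤ (y k - T) * X k := by
      intro k
      rcases le_total (y k - T) 0 with h | h
      · simp [hX, h]
      · exact mul_nonneg h (hX0 k)
    intro k
    by_contra hk
    have hk' := sub_pos.2 (not_le.1 hk)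
    have hXk : X k = y k - T := max_eq_left hk'.le
    have h5 : 0 < (f k + δ) * ((y k - T) * X k) := by
      rw [hXk]
      exact mul_pos (add_pos_of_nonneg_of_pos (hf0 k) hδ0) (mul_pos hk' hk')
    have h6 := Finset.single_le_sum (f := fun k => (f k + δ) * ((y k - T) * X k))
      (fun k _ => mul_nonneg (add_pos_of_nonneg_of_pos (hf0 k) hδ0).le (h4 k)) (Finset.mem_univ k)
    linarith
  refine ⟨y, hy, hy0, fun x p h => ?_, fun X hX hX0 hXc hXz => ?_⟩
  · obtain ⟨hm, h0, h1, hp⟩ := h.integral_p_le μ hε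
    rw [integral_comp_cell_mul μ y (h.integrable_x μ)]
    have h2 := hle _ hm h0
    have h3 : ∑ k, (f k + δ) * y k * cellAverage μ ε N x k ≤
        ∑ k, y k * ∫ v in {v | cell ε N v = k}, x v ∂μ + ε := by
      have h4 : ∀ k ∈ Finset.univ, (f k + δ) * y k * cellAverage μ ε N x k ≤
          y k * ∫ v in {v | cell ε N v = k}, x v ∂μ + δ * T := by
        intro k _
        rw [← mul_cellAverage]
        have h5 : y k * cellAverage μ ε N x k ≤ T * 1 :=
          mul_le_mul (hyT k) (h1 k) (h0 k) hT0
        have := mul_le_mul_of_nonneg_left h5 hδ0.le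
        simp only [hf]
        linarith
      refine (Finset.sum_le_sum h4).trans ?_
      rw [Finset.sum_add_distrib]
      gcongr
      rw [Finset.sum_const, Finset.card_univ, Fintype.card_fin, nsmul_eq_mul, hδ]
      push_cast
      rw [div_mul_eq_mul_div, mul_div_assoc', div_le_iff₀ (by positivity)]
      have : 0 ≤ ε * ((N : ℝ) + 1) := by positivity
      linarith
    linarith
  · rw [← expectedStepPay_eq, heq X hX hX0 hXc hXz, integral_comp_cell μ fun k => y k * X k]
    refine Finset.sum_le_sum fun k _ => ?_
    have := mul_nonneg hδ0.le (mul_nonneg (hy0 k) (hX0 k))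
    simp only [hf]
    linarith

end

end VirtualValue

/-! ### Matroid permutation environments are position environments -/

section Rank

variable (M : Matroid (Fin n))

/-- The rank of a set of agents. -/
def matroidRank (S : Finset (Fin n)) : ℕ := (M.eRk S).toNat

lemma coe_matroidRank (S : Finset (Fin n)) : (matroidRank M S : ℕ∞) = M.eRk S :=
  ENat.natCast_toNat (ne_top_of_le_ne_top (Set.encard_ne_top_iff.2 S.finite_toSet)
    (M.eRk_le_encard _))

lemma matroidRank_mono {S T : Finset (Fin n)} (h : S ⊆ T) : matroidRank M S ≤ matroidRank M T := by
  have := M.eRk_mono (Finset.coe_subset.2 h)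
  rw [← coe_matroidRank, ← coe_matroidRank] at this
  exact_mod_cast this

lemma card_le_matroidRank {I S : Finset (Fin n)} (hI : M.Indep (I : Set (Fin n))) (h : I ⊆ S) :
    I.card ≤ matroidRank M S := by
  have := hI.encard_le_eRk_of_subset (Finset.coe_subset.2 h)
  rw [← coe_matroidRank, Set.encard_coe_eq_coe_finsetCard] at this
  exact_mod_cast this

lemma matroidRank_empty : matroidRank M ∅ = 0 := by simp [matroidRank]

lemma matroidRank_insert_insert (S : Finset (Fin n)) (a b : Fin n) :
    matroidRank M (insert a (insert b S)) + matroidRank M S ≤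
      matroidRank M (insert a S) + matroidRank M (insert b S) := by
  have h := M.eRk_inter_add_eRk_union_le (insert a S : Finset (Fin n)) (insert b S : Finset (Fin n))
  rw [← Finset.coe_inter, ← Finset.coe_union, ← coe_matroidRank, ← coe_matroidRank,
    ← coe_matroidRank, ← coe_matroidRank] at h
  have h' : matroidRank M (insert a S ∩ insert b S) + matroidRank M (insert a S ∪ insert b S) ≤
      matroidRank M (insert a S) + matroidRank M (insert b S) := by exact_mod_cast h
  have h1 : matroidRank M S ≤ matroidRank M (insert a S ∩ insert b S) :=
    matroidRank_mono M (Finset.subset_inter (Finset.subset_insert _ _) (Finset.subset_insert _ _))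
  have h2 : matroidRank M (insert a (insert b S)) ≤ matroidRank M (insert a S ∪ insert b S) :=
    matroidRank_mono M (by intro x; simp only [Finset.mem_insert, Finset.mem_union]; tauto)
  omega

/-- The first `k` agents. -/
def firstAgents (n k : ℕ) : Finset (Fin n) := Finset.univ.filter fun i => i.val < k

lemma mem_firstAgents {k : ℕ} {i : Fin n} : i ∈ firstAgents n k ↔ i.val < k := by
  simp [firstAgents]

lemma firstAgents_mono {k l : ℕ} (h : k ≤ l) : firstAgents n k ⊆ firstAgents n l := fun _ hi =>
  mem_firstAgents.2 ((mem_firstAgents.1 hi).trans_le h)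

lemma firstAgents_succ (i : Fin n) : firstAgents n (i.val + 1) = insert i (firstAgents n i.val) := by
  ext j
  simp only [mem_firstAgents, Finset.mem_insert, Fin.ext_iff]
  omega

/-- The expected rank of a uniformly random set of `k` agents. -/
def avgRank (k : ℕ) : ℝ :=
  (∑ π : Equiv.Perm (Fin n), (matroidRank M ((firstAgents n k).map π.toEmbedding) : ℝ)) /
    (n.factorial : ℝ)

/-- The probability with which the agent in position `k` is served when the agents are served
greedily in order of their positions. -/
def posWeight (k : ℕ) : ℝ := avgRank M (k + 1) - avgRank M k

lemma avgRank_zero : avgRank M 0 = 0 := by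
  have : firstAgents n 0 = ∅ := by ext; simp [mem_firstAgents]
  simp [avgRank, this, matroidRank_empty]

lemma posWeight_nonneg (k : ℕ) : 0 ≤ posWeight M k := by
  refine sub_nonneg.2 (div_le_div_of_nonneg_right (Finset.sum_le_sum fun π _ => ?_) (by positivity))
  exact_mod_cast matroidRank_mono M (Finset.map_subset_map.2 (firstAgents_mono (Nat.le_succ k)))

lemma posWeight_eq_zero {k : ℕ} (h : n ≤ k) : posWeight M k = 0 := by
  have : firstAgents n (k + 1) = firstAgents n k := by
    ext i
    simp only [mem_firstAgents]
    have := i.2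
    omega
  simp [posWeight, avgRank, this]

lemma avgRank_eq_sum (k : ℕ) : avgRank M k = ∑ j ∈ Finset.range k, posWeight M j := by
  have := Finset.sum_range_sub (avgRank M) k
  rw [avgRank_zero, sub_zero] at this
  exact this.symm

/-- Marginal ranks decrease by submodularity. Composing the uniform permutation with the swap of
positions k and k + 1 shows that either agent adds the same average rank to the first k. -/
lemma posWeight_antitone : Antitone (posWeight M) := by
  refine antitone_nat_of_succ_le fun k => ?_
  rcases Nat.lt_or_ge (k + 1) n with hk | hk
  swap
  · rw [posWeight_eq_zero M hk]
    exact posWeight_nonneg M k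
  let a : Fin n := ⟨k, by omega⟩
  let b : Fin n := ⟨k + 1, hk⟩
  have h1 : firstAgents n (k + 1) = insert a (firstAgents n k) := firstAgents_succ a
  have h2 : firstAgents n (k + 1 + 1) = insert b (insert a (firstAgents n k)) := by
    rw [← h1]; exact firstAgents_succ b
  have h3 : (insert a (firstAgents n k)).map (Equiv.swap a b).toEmbedding =
      insert b (firstAgents n k) := by
    rw [Finset.map_insert]
    congr 1
    · simp
    · have : ∀ i ∈ firstAgents n k, Equiv.swap a b i = i := fun i hi => by
        have := mem_firstAgents.1 hi
        refine Equiv.swap_apply_of_ne_of_ne ?_ ?_ <;> rw [Ne, Fin.ext_iff] <;>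
          simp only [a, b] <;> omega
      rw [Finset.map_eq_image]
      exact (Finset.image_congr this).trans Finset.image_id
  have h4 : ∑ π : Equiv.Perm (Fin n),
        (matroidRank M ((insert a (firstAgents n k)).map π.toEmbedding) : ℝ) =
      ∑ π : Equiv.Perm (Fin n),
        (matroidRank M ((insert b (firstAgents n k)).map π.toEmbedding) : ℝ) := by
    rw [← Equiv.sum_comp (Equiv.mulRight (Equiv.swap a b))]
    refine Finset.sum_congr rfl fun π _ => ?_
    rw [← h3, Finset.map_map]
    rfl
  have h5 : ∑ π : Equiv.Perm (Fin n),
        (matroidRank M ((insert b (insert a (firstAgents n k))).map π.toEmbedding) : ℝ) +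
      ∑ π : Equiv.Perm (Fin n), (matroidRank M ((firstAgents n k).map π.toEmbedding) : ℝ) ≤
      ∑ π : Equiv.Perm (Fin n),
        (matroidRank M ((insert a (firstAgents n k)).map π.toEmbedding) : ℝ) +
      ∑ π : Equiv.Perm (Fin n),
        (matroidRank M ((insert a (firstAgents n k)).map π.toEmbedding) : ℝ) := by
    refine le_trans ?_ (add_le_add le_rfl h4.ge)
    rw [← Finset.sum_add_distrib, ← Finset.sum_add_distrib]
    refine Finset.sum_le_sum fun π _ => ?_
    simp only [Finset.map_insert]
    have := matroidRank_insert_insert M ((firstAgents n k).map π.toEmbedding)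
      (π.toEmbedding b) (π.toEmbedding a)
    rw [add_comm (matroidRank M (insert (π.toEmbedding b) ((firstAgents n k).map _)))] at this
    exact_mod_cast this
  have h6 : avgRank M (k + 1 + 1) + avgRank M k ≤ avgRank M (k + 1) + avgRank M (k + 1) := by
    simp only [avgRank, h2, h1, ← add_div]
    exact div_le_div_of_nonneg_right h5 (by positivity)
  simp only [posWeight]
  linarith

/-- An independent set that is obtained by the greedy algorithm for the order `π`. -/
lemma exists_greedy_indep (π : Equiv.Perm (Fin n)) :
    ∃ I : Finset (Fin n), M.Indep (I : Set (Fin n)) ∧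
      ∀ k, (I ∩ (firstAgents n k).map π.toEmbedding).card =
        matroidRank M ((firstAgents n k).map π.toEmbedding) := by
  classical
  have hle : ∀ (I : Finset (Fin n)), M.Indep (I : Set (Fin n)) → ∀ k,
      (I ∩ (firstAgents n k).map π.toEmbedding).card ≤
        matroidRank M ((firstAgents n k).map π.toEmbedding) := fun I hI k =>
    card_le_matroidRank M (hI.subset (Finset.coe_subset.2 Finset.inter_subset_left))
      Finset.inter_subset_right
  have main : ∀ m : ℕ, ∃ I : Finset (Fin n), M.Indep (I : Set (Fin n)) ∧
      I ⊆ (firstAgents n m).map π.toEmbedding ∧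
      ∀ k ≤ m, matroidRank M ((firstAgents n k).map π.toEmbedding) ≤
        (I ∩ (firstAgents n k).map π.toEmbedding).card := by
    intro m
    induction m with
    | zero =>
      refine ⟨∅, by simp, Finset.empty_subset _, fun k hk => ?_⟩
      have : firstAgents n k = ∅ := by ext; simp [mem_firstAgents, Nat.le_zero.1 hk]
      simp [this, matroidRank_empty]
    | succ m ih =>
      obtain ⟨I, hI, hIs, hIk⟩ := ih
      have hsub : I ⊆ (firstAgents n (m + 1)).map π.toEmbedding :=
        hIs.trans (Finset.map_subset_map.2 (firstAgents_mono (Nat.le_succ m)))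
      -- Extend the current independent set to a basis of the next prefix. It only grows, so the
      -- ranks of earlier prefixes stay attained.
      obtain ⟨J, hJ, hIJ⟩ := hI.subset_isBasis'_of_subset (Finset.coe_subset.2 hsub)
      obtain ⟨J', rfl⟩ : ∃ J' : Finset (Fin n), (J' : Set (Fin n)) = J :=
        ⟨J.toFinset, by simp⟩
      refine ⟨J', hJ.indep, Finset.coe_subset.1 hJ.subset, fun k hk => ?_⟩
      rcases Nat.le_or_eq_of_le_succ hk with hk | rfl
      · exact (hIk k hk).trans (Finset.card_le_card
          (Finset.inter_subset_inter_right (Finset.coe_subset.1 hIJ)))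
      · rw [Finset.inter_eq_left.2 (Finset.coe_subset.1 hJ.subset)]
        have := hJ.encard_eq_eRk
        rw [← coe_matroidRank, Set.encard_coe_eq_coe_finsetCard] at this
        exact (Nat.cast_injective (R := ℕ∞) this).ge
  obtain ⟨I, hI, hIs, hIk⟩ := main n
  refine ⟨I, hI, fun k => le_antisymm (hle I hI k) ?_⟩
  rcases le_total k n with hk | hk
  · exact hIk k hk
  · have : firstAgents n k = firstAgents n n := by
      ext i
      have := i.2
      simp only [mem_firstAgents]
      omega
    rw [this]
    exact hIk n le_rfl

end Rank

/-! ### Feasible allocations and their prefix bounds. -/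

section Allocations

variable {F : Set (Finset (Fin n))}

lemma mem_allocations_renamed (π : Equiv.Perm (Fin n)) (y : Fin n → ℝ) :
    y ∈ allocations (renamed π F) ↔ y ∘ π ∈ allocations F := by
  have h1 : (LinearMap.funLeft ℝ ℝ π) '' (served '' renamed π F) = served '' F := by
    rw [renamed, Set.image_image, Set.image_image]
    refine Set.image_congr fun S _ => ?_
    funext i
    simp [served, LinearMap.funLeft_apply]
  have h2 : (LinearMap.funLeft ℝ ℝ π) '' allocations (renamed π F) = allocations F := by
    rw [allocations, LinearMap.image_convexHull, h1, allocations]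
  rw [← h2]
  constructor
  · exact fun h => ⟨y, h, rfl⟩
  · rintro ⟨y', hy', h⟩
    have : y' = y := LinearMap.funLeft_injective_of_surjective ℝ ℝ _ π.surjective h
    exact this ▸ hy'

/-- Instead of renaming the set system, let agent i take the role π i in the fixed one; the two
descriptions differ by the inversion of π. -/
lemma mem_permAllocations_iff {x : Fin n → ℝ} : x ∈ permAllocations F ↔
    ∃ z : Equiv.Perm (Fin n) → Fin n → ℝ, (∀ π, z π ∈ allocations F) ∧
      ∀ i, x i = (∑ π, z π (π i)) / (n.factorial : ℝ) := by
  constructor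
  · rintro ⟨y, hy, hx⟩
    refine ⟨fun π => y π⁻¹ ∘ ⇑π⁻¹, fun π => (mem_allocations_renamed _ _).1 (hy _), fun i => ?_⟩
    rw [hx, ← Equiv.sum_comp (Equiv.inv (Equiv.Perm (Fin n)))]
    simp
  · rintro ⟨z, hz, hx⟩
    refine ⟨fun π => z π⁻¹ ∘ ⇑π⁻¹, fun π => (mem_allocations_renamed _ _).2 ?_, fun i => ?_⟩
    · have : (z π⁻¹ ∘ ⇑π⁻¹) ∘ ⇑π = z π⁻¹ := by funext i; simp
      rw [this]
      exact hz _
    · rw [hx, ← Equiv.sum_comp (Equiv.inv (Equiv.Perm (Fin n)))]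
      simp

lemma comp_perm_mem {x : Fin n → ℝ} (hx : x ∈ permAllocations F) (σ : Equiv.Perm (Fin n)) :
    x ∘ σ ∈ permAllocations F := by
  obtain ⟨z, hz, hx⟩ := mem_permAllocations_iff.1 hx
  refine mem_permAllocations_iff.2 ⟨fun π => z (π * σ⁻¹), fun π => hz _, fun i => ?_⟩
  rw [Function.comp_apply, hx, ← Equiv.sum_comp (Equiv.mulRight σ⁻¹)]
  simp

lemma convex_permAllocations : Convex ℝ (permAllocations F) := by
  intro x hx x' hx' a b ha hb hab
  obtain ⟨z, hz, hx⟩ := mem_permAllocations_iff.1 hx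
  obtain ⟨z', hz', hx'⟩ := mem_permAllocations_iff.1 hx'
  refine mem_permAllocations_iff.2 ⟨fun π => a • z π + b • z' π, fun π =>
    (convex_convexHull ℝ _) (hz π) (hz' π) ha hb hab, fun i => ?_⟩
  simp only [Pi.add_apply, Pi.smul_apply, smul_eq_mul, hx, hx', Finset.sum_add_distrib,
    ← Finset.mul_sum]
  ring

lemma permAllocations_nonneg {x : Fin n → ℝ} (hx : x ∈ permAllocations F) (i : Fin n) :
    0 ≤ x i := by
  obtain ⟨z, hz, hx⟩ := mem_permAllocations_iff.1 hx
  rw [hx]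
  refine div_nonneg (Finset.sum_nonneg fun π _ => ?_) (by positivity)
  have : allocations F ⊆ {y | 0 ≤ y (π i)} := by
    refine convexHull_min ?_ (convex_halfSpace_ge (LinearMap.isLinear (LinearMap.proj (π i))) 0)
    rintro _ ⟨S, _, rfl⟩
    simp only [served, Set.mem_ofPred_eq]
    split_ifs <;> norm_num
  exact this (hz π)

variable {M : Matroid (Fin n)}

lemma sum_le_matroidRank {z : Fin n → ℝ} (hz : z ∈ allocations (matroidFeasible M))
    (S : Finset (Fin n)) : ∑ i ∈ S, z i ≤ matroidRank M S := by
  classical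
  have : allocations (matroidFeasible M) ⊆ {y | ∑ i ∈ S, y i ≤ matroidRank M S} := by
    refine convexHull_min ?_ (convex_halfSpace_le
      (IsLinearMap.mk (fun x y => by simp [Finset.sum_add_distrib])
        fun c x => by simp [Finset.mul_sum]) _)
    rintro _ ⟨I, hI, rfl⟩
    have : ∑ i ∈ S, served I i = ((I ∩ S).card : ℝ) := by
      simp [served, Finset.inter_comm]
    rw [Set.mem_ofPred_eq, this]
    exact_mod_cast card_le_matroidRank M (Matroid.Indep.subset hI
      (Finset.coe_subset.2 Finset.inter_subset_left)) Finset.inter_subset_right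
  exact this hz

/-- For each π the rank bounds the service of the roles taken by the first k agents. The bound for
other sets of k agents follows from symmetry, `comp_perm_mem`. -/
lemma sum_firstAgents_le {x : Fin n → ℝ} (hx : x ∈ permAllocations (matroidFeasible M)) (k : ℕ) :
    ∑ i ∈ firstAgents n k, x i ≤ avgRank M k := by
  obtain ⟨z, hz, hx⟩ := mem_permAllocations_iff.1 hx
  simp only [hx]
  rw [← Finset.sum_div, avgRank, Finset.sum_comm]
  refine div_le_div_of_nonneg_right (Finset.sum_le_sum fun π _ => ?_) (by positivity)
  have := sum_le_matroidRank (hz π) ((firstAgents n k).map π.toEmbedding)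
  rwa [Finset.sum_map] at this

/-- Serving the agents of `D` greedily in order of their positions. -/
lemma posWeight_mem (D : Finset (Fin n)) :
    (fun k : Fin n => if k ∈ D then posWeight M k.val else 0) ∈
      permAllocations (matroidFeasible M) := by
  classical
  choose I hI hIk using exists_greedy_indep M
  refine mem_permAllocations_iff.2 ⟨fun π => served (I π ∩ D.map π.toEmbedding), fun π =>
    subset_convexHull ℝ _ ⟨_, (hI π).subset (Finset.coe_subset.2 Finset.inter_subset_left), rfl⟩,
    fun i => ?_⟩
  by_cases hi : i ∈ D
  · simp only [hi, if_true, posWeight, avgRank]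
    rw [← sub_div, ← Finset.sum_sub_distrib]
    congr 1
    refine Finset.sum_congr rfl fun π _ => ?_
    rw [← hIk, ← hIk, firstAgents_succ, Finset.map_insert]
    have hni : π i ∉ I π ∩ (firstAgents n i.val).map π.toEmbedding := by
      simp [mem_firstAgents]
    by_cases hm : π i ∈ I π
    · rw [Finset.inter_insert_of_mem (by simpa using hm)]
      rw [Finset.card_insert_of_notMem (by simpa using hni)]
      simp [served, hm, hi]
    · rw [Finset.inter_insert_of_notMem (by simpa using hm)]
      simp [served, hm]
  · simp [hi, served]

lemma le_avgRank_one {x : Fin n → ℝ} (hx : x ∈ permAllocations (matroidFeasible M)) (i : Fin n) :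
    x i ≤ avgRank M 1 := by
  have hn : 0 < n := i.pos
  have h := sum_firstAgents_le (comp_perm_mem hx (Equiv.swap ⟨0, hn⟩ i)) 1
  have h1 : firstAgents n 1 = {⟨0, hn⟩} := by
    ext j
    simp [mem_firstAgents, Fin.ext_iff]
  simpa [h1] using h

end Allocations

/-! ### The greedy allocation -/

/-- Pass through the window [a, b'). Extending on the right adds terms no larger than those present;
cutting on the left removes terms no smaller than those that remain. -/
lemma average_antitone {c : ℕ → ℝ} (hc : Antitone c) {a b a' b' : ℕ} (ha : a ≤ a') (hb : b ≤ b')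
    (hab : a < b) (hab' : a' < b') :
    (∑ k ∈ Finset.Ico a' b', c k) / (b' - a' : ℝ) ≤ (∑ k ∈ Finset.Ico a b, c k) / (b - a : ℝ) := by
  have upper : ∀ s t : ℕ, s ≤ t → ∑ k ∈ Finset.Ico s t, c k ≤ (t - s : ℝ) * c s := by
    intro s t hst
    have := Finset.sum_le_card_nsmul (Finset.Ico s t) c (c s)
      fun k hk => hc (Finset.mem_Ico.1 hk).1
    rwa [Nat.card_Ico, nsmul_eq_mul, Nat.cast_sub hst] at this
  have lower : ∀ s t : ℕ, s ≤ t → (t - s : ℝ) * c t ≤ ∑ k ∈ Finset.Ico s t, c k := by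
    intro s t hst
    have := Finset.card_nsmul_le_sum (Finset.Ico s t) c (c t)
      fun k hk => hc (Finset.mem_Ico.1 hk).2.le
    rwa [Nat.card_Ico, nsmul_eq_mul, Nat.cast_sub hst] at this
  have hab1 : (a : ℝ) < b := by exact_mod_cast hab
  have hab2 : (a' : ℝ) < b' := by exact_mod_cast hab'
  have hb1 : (b : ℝ) ≤ b' := by exact_mod_cast hb
  have ha1 : (a : ℝ) ≤ a' := by exact_mod_cast ha
  calc (∑ k ∈ Finset.Ico a' b', c k) / (b' - a' : ℝ)
      ≤ (∑ k ∈ Finset.Ico a b', c k) / (b' - a : ℝ) := by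
        rw [div_le_div_iff₀ (by linarith) (by linarith),
          ← Finset.sum_Ico_consecutive c ha hab'.le]
        have h1 := mul_le_mul_of_nonneg_right (upper a' b' hab'.le) (sub_nonneg.2 ha1)
        have h2 := mul_le_mul_of_nonneg_right (lower a a' ha) (sub_nonneg.2 hab2.le)
        nlinarith
    _ ≤ _ := by
        rw [div_le_div_iff₀ (by linarith) (by linarith),
          ← Finset.sum_Ico_consecutive c hab.le hb]
        have h1 := mul_le_mul_of_nonneg_right (upper b b' hb) (sub_nonneg.2 hab1.le)
        have h2 := mul_le_mul_of_nonneg_right (lower a b hab.le) (sub_nonneg.2 hb1)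
        nlinarith

/-- The number of agents whose weight is larger than that of agent `i`. -/
def numAbove (w : Fin n → ℝ) (i : Fin n) : ℕ := (Finset.univ.filter fun j => w i < w j).card

/-- The number of agents whose weight is at least that of agent `i`. -/
def numAtLeast (w : Fin n → ℝ) (i : Fin n) : ℕ := (Finset.univ.filter fun j => w i ≤ w j).card

lemma numAbove_lt_numAtLeast (w : Fin n → ℝ) (i : Fin n) : numAbove w i < numAtLeast w i :=
  Finset.card_lt_card ⟨fun j hj => by
    simp only [Finset.mem_filter, Finset.mem_univ, true_and] at hj ⊢
    exact hj.le, fun h => by simpa using h (Finset.mem_filter.2 ⟨Finset.mem_univ i, le_rfl⟩)⟩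

/-- The agents of positive weight are served greedily in order of decreasing weights, where
ties are broken uniformly at random. -/
def greedyAlloc (M : Matroid (Fin n)) (w : Fin n → ℝ) (i : Fin n) : ℝ :=
  if 0 < w i then (∑ k ∈ Finset.Ico (numAbove w i) (numAtLeast w i), posWeight M k) /
    (numAtLeast w i - numAbove w i : ℝ) else 0

/-! ### Monotonicity, feasibility and optimality of the greedy allocation. -/

section Greedy

variable (M : Matroid (Fin n))

lemma greedyAlloc_nonneg (w : Fin n → ℝ) (i : Fin n) : 0 ≤ greedyAlloc M w i := by
  unfold greedyAlloc
  split_ifs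
  · have h : (numAbove w i : ℝ) ≤ numAtLeast w i := by
      exact_mod_cast (numAbove_lt_numAtLeast w i).le
    exact div_nonneg (Finset.sum_nonneg fun k _ => posWeight_nonneg M k) (sub_nonneg.2 h)
  · rfl

/-- A share depends on the profile only through the sign of the weight and two counts. Different
agents in different profiles can thus be compared by counting, as the envy-free comparison requires.
-/
lemma greedyAlloc_le_greedyAlloc {w w' : Fin n → ℝ} {i i' : Fin n} (hpos : 0 < w' i' → 0 < w i)
    (habove : numAbove w i ≤ numAbove w' i') (hatLeast : numAtLeast w i ≤ numAtLeast w' i') :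
    greedyAlloc M w' i' ≤ greedyAlloc M w i := by
  by_cases h : 0 < w' i'
  · have h1 := average_antitone (posWeight_antitone M) habove hatLeast
      (numAbove_lt_numAtLeast w i) (numAbove_lt_numAtLeast w' i')
    simpa only [greedyAlloc, h, hpos h, if_true] using h1
  · have : greedyAlloc M w' i' = 0 := by simp [greedyAlloc, h]
    rw [this]
    exact greedyAlloc_nonneg M w i

/-- An agent is served more often if her weight increases and those of the others decrease. -/
lemma greedyAlloc_le_of_others_le {w w' : Fin n → ℝ} {i : Fin n} (hi : w' i ≤ w i)
    (h : ∀ j, j ≠ i → w j ≤ w' j) : greedyAlloc M w' i ≤ greedyAlloc M w i := by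
  refine greedyAlloc_le_greedyAlloc M (fun h0 => h0.trans_le hi) ?_ ?_
  · refine Finset.card_le_card fun j hj => ?_
    simp only [Finset.mem_filter, Finset.mem_univ, true_and] at hj ⊢
    rcases eq_or_ne j i with rfl | hne
    · exact absurd hj (lt_irrefl _)
    · exact hi.trans_lt (hj.trans_le (h j hne))
  · refine Finset.card_le_card fun j hj => ?_
    simp only [Finset.mem_filter, Finset.mem_univ, true_and] at hj ⊢
    rcases eq_or_ne j i with rfl | hne
    · rfl
    · exact hi.trans (hj.trans (h j hne))

lemma greedyAlloc_mono {w : Fin n → ℝ} {i j : Fin n} (h : w i ≤ w j) :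
    greedyAlloc M w i ≤ greedyAlloc M w j := by
  refine greedyAlloc_le_greedyAlloc M (fun h0 => h0.trans_le h) ?_ ?_ <;>
  · refine Finset.card_le_card fun k hk => ?_
    simp only [Finset.mem_filter, Finset.mem_univ, true_and] at hk ⊢
    order

lemma exists_sort (w : Fin n → ℝ) : ∃ σ : Equiv.Perm (Fin n), Antitone (w ∘ σ) :=
  ⟨Tuple.sort fun i => -w i, fun i j hij => by
    simpa using Tuple.monotone_sort (fun i => -w i) hij⟩

variable {w : Fin n → ℝ} {σ : Equiv.Perm (Fin n)}

lemma lt_numAbove_iff (hσ : Antitone (w ∘ σ)) (i k : Fin n) :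
    k.val < numAbove w i ↔ w i < w (σ k) := by
  have h := Tuple.lt_card_gt_iff_apply_gt_of_antitone (a := w i) (j := k) hσ
  rw [← Function.comp_apply (f := w), ← h, numAbove]
  have : (Finset.univ.filter fun j => w i < w j) =
      (Finset.univ.filter fun j => w i < (w ∘ σ) j).map σ.toEmbedding := by
    ext j
    simp [Finset.mem_map_equiv]
  rw [this, Finset.card_map]

lemma lt_numAtLeast_iff (hσ : Antitone (w ∘ σ)) (i k : Fin n) :
    k.val < numAtLeast w i ↔ w i ≤ w (σ k) := by
  have h := Tuple.lt_card_ge_iff_apply_ge_of_antitone (a := w i) (j := k) hσ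
  rw [← Function.comp_apply (f := w), ← h, numAtLeast]
  have : (Finset.univ.filter fun j => w i ≤ w j) =
      (Finset.univ.filter fun j => w i ≤ (w ∘ σ) j).map σ.toEmbedding := by
    ext j
    simp [Finset.mem_map_equiv]
  rw [this, Finset.card_map]

/-- The greedy allocation when ties are broken according to the order `σ`. -/
def sortedAlloc (w : Fin n → ℝ) (σ : Equiv.Perm (Fin n)) (i : Fin n) : ℝ :=
  if 0 < w i then posWeight M (σ.symm i).val else 0

lemma sortedAlloc_mem (w : Fin n → ℝ) (σ : Equiv.Perm (Fin n)) :
    sortedAlloc M w σ ∈ permAllocations (matroidFeasible M) := by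
  have h := comp_perm_mem (posWeight_mem (M := M) (Finset.univ.filter fun k => 0 < w (σ k))) σ.symm
  convert h using 1
  funext i
  simp [sortedAlloc]

lemma sum_block_sortedAlloc (hσ : Antitone (w ∘ σ)) {i : Fin n} (hi : 0 < w i) :
    ∑ j ∈ Finset.univ.filter (fun j => w j = w i), sortedAlloc M w σ j =
      ∑ k ∈ Finset.Ico (numAbove w i) (numAtLeast w i), posWeight M k := by
  have hle : numAtLeast w i ≤ n := by
    simpa [numAtLeast] using Finset.card_le_univ (Finset.univ.filter fun j => w i ≤ w j)
  refine Finset.sum_bij (fun j _ => (σ.symm j).val) ?_ ?_ ?_ ?_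
  · intro j hj
    have hj' : w j = w i := (Finset.mem_filter.1 hj).2
    have h1 := lt_numAbove_iff hσ i (σ.symm j)
    have h2 := lt_numAtLeast_iff hσ i (σ.symm j)
    rw [Equiv.apply_symm_apply] at h1 h2
    rw [Finset.mem_Ico]
    exact ⟨not_lt.1 fun h => (h1.1 h).ne' hj', h2.2 hj'.ge⟩
  · intro j _ j' _ h
    exact σ.symm.injective (Fin.ext h)
  · intro k hk
    rw [Finset.mem_Ico] at hk
    let k' : Fin n := ⟨k, hk.2.trans_le hle⟩
    refine ⟨σ k', ?_, by simp [k']⟩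
    have h1 := lt_numAbove_iff hσ i k'
    have h2 := lt_numAtLeast_iff hσ i k'
    rw [Finset.mem_filter]
    exact ⟨Finset.mem_univ _, le_antisymm (not_lt.1 fun h => hk.1.not_gt (h1.2 h)) (h2.1 hk.2)⟩
  · intro j hj
    have hj' : w j = w i := (Finset.mem_filter.1 hj).2
    simp [sortedAlloc, hj', hi]

/-- The permutations that preserve the weights. -/
def tieBreakers (w : Fin n → ℝ) : Finset (Equiv.Perm (Fin n)) :=
  Finset.univ.filter fun τ => ∀ i, w (τ i) = w i

lemma mem_tieBreakers {τ : Equiv.Perm (Fin n)} : τ ∈ tieBreakers w ↔ ∀ i, w (τ i) = w i := by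
  simp [tieBreakers]

lemma card_tieBreakers_pos (w : Fin n → ℝ) : (0 : ℝ) < (tieBreakers w).card := by
  have : 1 ∈ tieBreakers w := mem_tieBreakers.2 fun i => rfl
  exact_mod_cast Finset.card_pos.2 ⟨1, this⟩

/-- Swapping two tied agents permutes the tie breakers, so the average is constant on a block of
ties. The total service of the block is the sum of the weights of the positions it occupies. -/
lemma greedyAlloc_eq_average (hσ : Antitone (w ∘ σ)) (i : Fin n) :
    greedyAlloc M w i =
      (∑ τ ∈ tieBreakers w, sortedAlloc M w σ (τ i)) / (tieBreakers w).card := by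
  have hc := card_tieBreakers_pos w
  by_cases hi : 0 < w i
  swap
  · have h0 : ∀ τ ∈ tieBreakers w, sortedAlloc M w σ (τ i) = 0 := fun τ hτ => by
      simp [sortedAlloc, mem_tieBreakers.1 hτ i, hi]
    rw [Finset.sum_eq_zero h0]
    simp [greedyAlloc, hi]
  set a : Fin n → ℝ := fun i => ∑ τ ∈ tieBreakers w, sortedAlloc M w σ (τ i) with ha
  set B := Finset.univ.filter (fun j => w j = w i) with hB
  have h1 : ∀ j ∈ B, a j = a i := by
    intro j hj
    have hj' : w j = w i := (Finset.mem_filter.1 hj).2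
    have hsw : ∀ k, w (Equiv.swap i j k) = w k := by
      intro k
      rcases eq_or_ne k i with rfl | hki
      · rw [Equiv.swap_apply_left, hj']
      rcases eq_or_ne k j with rfl | hkj
      · rw [Equiv.swap_apply_right, hj']
      · rw [Equiv.swap_apply_of_ne_of_ne hki hkj]
    refine Finset.sum_bij (fun τ _ => τ * Equiv.swap i j) ?_ ?_ ?_ ?_
    · intro τ hτ
      exact mem_tieBreakers.2 fun k => by
        rw [Equiv.Perm.mul_apply, mem_tieBreakers.1 hτ, hsw]
    · intro τ _ τ' _ h
      exact mul_right_cancel h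
    · intro τ hτ
      refine ⟨τ * Equiv.swap i j, mem_tieBreakers.2 fun k => by
        rw [Equiv.Perm.mul_apply, mem_tieBreakers.1 hτ, hsw], ?_⟩
      rw [mul_assoc, Equiv.swap_mul_self, mul_one]
    · intro τ _
      simp
  have h2 : ∑ j ∈ B, a j = (tieBreakers w).card *
      ∑ k ∈ Finset.Ico (numAbove w i) (numAtLeast w i), posWeight M k := by
    rw [ha, Finset.sum_comm, ← sum_block_sortedAlloc M hσ hi, ← nsmul_eq_mul, ← Finset.sum_const]
    refine Finset.sum_congr rfl fun τ hτ => ?_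
    refine Finset.sum_equiv τ (fun j => ?_) fun _ _ => rfl
    simp [hB, mem_tieBreakers.1 hτ j]
  rw [Finset.sum_congr rfl h1, Finset.sum_const, nsmul_eq_mul] at h2
  have h3 : (B.card : ℝ) = numAtLeast w i - numAbove w i := by
    have : B.card + numAbove w i = numAtLeast w i := by
      rw [numAbove, numAtLeast, ← Finset.card_union_of_disjoint]
      · congr 1
        ext j
        simp only [hB, Finset.mem_union, Finset.mem_filter, Finset.mem_univ, true_and,
          le_iff_eq_or_lt, eq_comm]
      · rw [Finset.disjoint_filter]
        intro j _ h h'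
        exact h'.ne h.symm
    rw [← this]
    push_cast
    ring
  have h4 : (0 : ℝ) < numAtLeast w i - numAbove w i :=
    sub_pos.2 (by exact_mod_cast numAbove_lt_numAtLeast w i)
  rw [greedyAlloc, if_pos hi, div_eq_div_iff h4.ne' hc.ne', ← h3]
  linarith

lemma greedyAlloc_mem (w : Fin n → ℝ) :
    greedyAlloc M w ∈ permAllocations (matroidFeasible M) := by
  obtain ⟨σ, hσ⟩ := exists_sort w
  have hc := card_tieBreakers_pos w
  have h := (convex_permAllocations (F := matroidFeasible M)).sum_mem (t := tieBreakers w)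
    (w := fun _ => 1 / ((tieBreakers w).card : ℝ)) (z := fun τ => sortedAlloc M w σ ∘ τ)
    (fun _ _ => by positivity) (by rw [Finset.sum_const, nsmul_eq_mul]; field_simp)
    fun τ _ => comp_perm_mem (sortedAlloc_mem M w σ) τ
  convert h using 1
  funext i
  rw [greedyAlloc_eq_average M hσ, Finset.sum_apply, Finset.sum_div]
  refine Finset.sum_congr rfl fun τ _ => ?_
  simp only [Pi.smul_apply, Function.comp_apply, smul_eq_mul]
  ring

lemma sum_mul_nonneg_of_antitone {v d : ℕ → ℝ} (hv : Antitone v) (hv0 : ∀ k, 0 ≤ v k)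
    (hd : ∀ k, 0 ≤ ∑ i ∈ Finset.range k, d i) (k : ℕ) :
    0 ≤ ∑ i ∈ Finset.range k, v i * d i := by
  -- Abel summation as an induction; the lower bound is kept in terms of the current v k so that it
  -- passes to the smaller v (k + 1).
  have main : ∀ k, v k * ∑ i ∈ Finset.range k, d i ≤ ∑ i ∈ Finset.range k, v i * d i := by
    intro k
    induction k with
    | zero => simp
    | succ k ih =>
      have h1 := mul_le_mul_of_nonneg_right (hv (Nat.le_succ k)) (hd (k + 1))
      rw [Finset.sum_range_succ] at h1
      rw [Finset.sum_range_succ, Finset.sum_range_succ]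
      linarith
  exact (mul_nonneg (hv0 k) (hd k)).trans (main k)

/-- The greedy allocation is a feasible allocation of maximal weight. -/
lemma sum_mul_le_sum_mul_greedyAlloc (hw : ∀ i, 0 ≤ w i) {x : Fin n → ℝ}
    (hx : x ∈ permAllocations (matroidFeasible M)) :
    ∑ i, w i * x i ≤ ∑ i, w i * greedyAlloc M w i := by
  obtain ⟨σ, hσ⟩ := exists_sort w
  have hc := card_tieBreakers_pos w
  have h1 : ∑ i, w i * greedyAlloc M w i = ∑ i, w i * sortedAlloc M w σ i := by
    simp_rw [greedyAlloc_eq_average M hσ, mul_div_assoc', ← Finset.sum_div, Finset.mul_sum]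
    rw [Finset.sum_comm, div_eq_iff hc.ne', mul_comm _ ((tieBreakers w).card : ℝ),
      ← nsmul_eq_mul, ← Finset.sum_const]
    refine Finset.sum_congr rfl fun τ hτ => ?_
    refine Fintype.sum_equiv τ _ _ fun i => ?_
    rw [mem_tieBreakers.1 hτ i]
  have h2 : ∑ i, w i * sortedAlloc M w σ i = ∑ k, w (σ k) * posWeight M k.val := by
    rw [← Equiv.sum_comp σ]
    refine Finset.sum_congr rfl fun k _ => ?_
    rcases (hw (σ k)).eq_or_lt with h | h
    · simp [← h]
    · simp [sortedAlloc, h]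
  rw [h1, h2, ← Equiv.sum_comp σ, ← sub_nonneg, ← Finset.sum_sub_distrib]
  -- Sorted weights and position slacks, extended by zero beyond n; the partial sums of the slacks
  -- are non-negative by the prefix bounds.
  let v : ℕ → ℝ := fun k => if h : k < n then w (σ ⟨k, h⟩) else 0
  let d : ℕ → ℝ := fun k => if h : k < n then posWeight M k - x (σ ⟨k, h⟩) else 0
  have hv : Antitone v := by
    intro j k hjk
    by_cases hk : k < n
    · have hj : j < n := by omega
      simp only [v, hk, hj, dif_pos]
      exact hσ (Fin.mk_le_mk.2 hjk)
    · simp only [v, hk, dif_neg, not_false_eq_true]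
      split_ifs
      · exact hw _
      · rfl
  have hv0 : ∀ k, 0 ≤ v k := fun k => by
    simp only [v]
    split_ifs
    · exact hw _
    · rfl
  have hd : ∀ k, 0 ≤ ∑ i ∈ Finset.range k, d i := by
    have hsmall : ∀ k ≤ n, 0 ≤ ∑ i ∈ Finset.range k, d i := by
      intro k hk
      have h3 := sum_firstAgents_le (comp_perm_mem hx σ) k
      rw [avgRank_eq_sum, ← sub_nonneg] at h3
      refine h3.trans (le_of_eq ?_)
      have h4 : ∑ i ∈ firstAgents n k, (x ∘ σ) i =
          ∑ i ∈ Finset.range k, if h : i < n then x (σ ⟨i, h⟩) else 0 := by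
        refine Finset.sum_bij (fun i _ => i.val) (fun i hi => ?_) (fun i _ j _ h => Fin.ext h)
          (fun i hi => ?_) fun i _ => by simp
        · exact Finset.mem_range.2 (mem_firstAgents.1 hi)
        · have hi' := Finset.mem_range.1 hi
          exact ⟨⟨i, hi'.trans_le hk⟩, mem_firstAgents.2 hi', rfl⟩
      rw [h4, ← Finset.sum_sub_distrib]
      refine Finset.sum_congr rfl fun i hi => ?_
      have : i < n := (Finset.mem_range.1 hi).trans_le hk
      simp [d, this]
    intro k
    rcases le_total k n with hk | hk
    · exact hsmall k hk
    · rw [← Finset.sum_range_add_sum_Ico _ hk]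
      have : ∑ i ∈ Finset.Ico n k, d i = 0 := Finset.sum_eq_zero fun i hi => by
        simp [d, (Finset.mem_Ico.1 hi).1.not_gt]
      rw [this, add_zero]
      exact hsmall n le_rfl
  have h5 := sum_mul_nonneg_of_antitone hv hv0 hd n
  rw [← Fin.sum_univ_eq_sum_range (fun k => v k * d k) n] at h5
  refine h5.trans (le_of_eq (Finset.sum_congr rfl fun k _ => ?_))
  simp only [v, d, k.2, dif_pos, Fin.eta]
  ring

end Greedy

/-! ### General facts on mechanisms -/

namespace Mechanism

variable {A : Set (Fin n → ℝ)} (m : Mechanism A)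

lemma slice_ic (v : Fin n → ℝ≥0) (i : Fin n) (a b : ℝ≥0) :
    (a : ℝ) * m.alloc (Function.update v i b) i - m.pay (Function.update v i b) i ≤
      a * m.alloc (Function.update v i a) i - m.pay (Function.update v i a) i := by
  simpa using m.incentiveCompatible (Function.update v i a) i b

lemma slice_ir (v : Fin n → ℝ≥0) (i : Fin n) (a : ℝ≥0) :
    0 ≤ (a : ℝ) * m.alloc (Function.update v i a) i - m.pay (Function.update v i a) i := by
  simpa using m.individuallyRational (Function.update v i a) i

lemma slice_alloc_mono (v : Fin n → ℝ≥0) (i : Fin n) :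
    Monotone fun a => m.alloc (Function.update v i a) i := by
  intro a b hab
  rcases hab.eq_or_lt with rfl | hlt
  · rfl
  have h1 := m.slice_ic v i a b
  have h2 := m.slice_ic v i b a
  have h3 : (0 : ℝ) < b - a := sub_pos.2 (by exact_mod_cast hlt)
  by_contra hc
  have := mul_pos h3 (sub_pos.2 (not_le.1 hc))
  simp only at this
  linarith

lemma mul_le_slice_pay_sub (v : Fin n → ℝ≥0) (i : Fin n) (a b : ℝ≥0) :
    (a : ℝ) * (m.alloc (Function.update v i b) i - m.alloc (Function.update v i a) i) ≤
      m.pay (Function.update v i b) i - m.pay (Function.update v i a) i := by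
  have := m.slice_ic v i a b
  linarith

lemma measurable_update (i : Fin n) {h : (Fin n → ℝ≥0) → ℝ≥0} (hh : Measurable h) :
    Measurable fun v : Fin n → ℝ≥0 => Function.update v i (h v) := by
  refine measurable_pi_iff.2 fun j => ?_
  rcases eq_or_ne j i with rfl | hne
  · simpa using hh
  · simpa [Function.update_of_ne hne] using measurable_pi_apply j

lemma measurable_pay_apply (i : Fin n) : Measurable fun v => m.pay v i :=
  (measurable_pi_apply i).comp m.measurable_pay

lemma measurable_alloc_apply (i : Fin n) : Measurable fun v => m.alloc v i :=
  (measurable_pi_apply i).comp m.measurable_alloc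

/-! ### Truncated reports -/

lemma min_update (v : Fin n → ℝ≥0) (i : Fin n) (z T : ℝ≥0) :
    (fun j => min (Function.update v i z j) T) =
      Function.update (fun j => min (v j) T) i (min z T) := by
  funext j
  rcases eq_or_ne j i with rfl | hne
  · simp
  · simp [Function.update_of_ne hne]

/-- The mechanism that lowers all values above `T` to `T`. -/
def cap (hA : ∀ x ∈ A, ∀ i, 0 ≤ x i) (T : ℝ≥0) : Mechanism A where
  alloc v := m.alloc fun j => min (v j) T
  pay v := m.pay fun j => min (v j) T
  measurable_alloc := m.measurable_alloc.comp
    (measurable_pi_iff.2 fun j => (measurable_pi_apply j).min measurable_const)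
  measurable_pay := m.measurable_pay.comp
    (measurable_pi_iff.2 fun j => (measurable_pi_apply j).min measurable_const)
  feasible v := m.feasible _
  individuallyRational v i := by
    have h := m.individuallyRational (fun j => min (v j) T) i
    have h0 := hA _ (m.feasible fun j => min (v j) T) i
    have h1 : ((min (v i) T : ℝ≥0) : ℝ) ≤ v i := by exact_mod_cast min_le_left _ _
    have := mul_le_mul_of_nonneg_right h1 h0
    linarith
  incentiveCompatible v i z := by
    simp only [min_update]
    set w : Fin n → ℝ≥0 := fun j => min (v j) T with hw
    have hwi : w = Function.update w i (min (v i) T) := by simp [hw]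
    rw [show m.alloc w i = m.alloc (Function.update w i (min (v i) T)) i from by rw [← hwi],
      show m.pay w i = m.pay (Function.update w i (min (v i) T)) i from by rw [← hwi]]
    have h1 := m.slice_ic w i (min (v i) T) (min z T)
    rcases le_total (v i) T with h | h
    · rwa [min_eq_left h] at h1 ⊢
    -- For a value above T the excess v i - T only strengthens the preference for T, because service
    -- is monotone in the report.
    · rw [min_eq_right h] at h1 ⊢
      have h2 := m.slice_alloc_mono w i (min_le_right z T)
      have h3 : (0 : ℝ) ≤ v i - T := sub_nonneg.2 (by exact_mod_cast h)
      have h4 := mul_le_mul_of_nonneg_left h2 h3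
      simp only at h4
      linarith

lemma cappedMenu_cap (hA : ∀ x ∈ A, ∀ i, 0 ≤ x i) (hA1 : ∀ x ∈ A, ∀ i, x i ≤ 1) (T : ℝ≥0)
    (v : Fin n → ℝ≥0) (i : Fin n) :
    CappedMenu (fun z => (m.cap hA T).alloc (Function.update v i z) i)
      (fun z => (m.cap hA T).pay (Function.update v i z) i) T where
  measurable_x := ((m.cap hA T).measurable_alloc_apply i).comp (_root_.measurable_update v)
  measurable_p := measurable_coe_nnreal_real.comp
    (((m.cap hA T).measurable_pay_apply i).comp (_root_.measurable_update v))
  ic a b := (m.cap hA T).slice_ic v i a b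
  ir a := (m.cap hA T).slice_ir v i a
  x_nonneg z := hA _ ((m.cap hA T).feasible _) i
  x_le_one z := hA1 _ ((m.cap hA T).feasible _) i
  p_nonneg z := NNReal.coe_nonneg _
  x_cap z hz := by simp [cap, min_update, hz]
  p_cap z hz := by simp [cap, min_update, hz]

/-- The expected revenue is the limit of the expected revenues of truncated mechanisms. -/
lemma expectedRevenue_le_of_cap (hA : ∀ x ∈ A, ∀ i, 0 ≤ x i) (μ : Measure ℝ≥0)
    [IsProbabilityMeasure μ] {T : ℕ → ℝ≥0} (hT : ∀ s : ℕ, (s : ℝ≥0) ≤ T s) {c : ℕ → ℝ≥0∞}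
    {C : ℝ≥0∞} (hc : Filter.Tendsto c Filter.atTop (nhds C))
    (h : ∀ s, (m.cap hA (T s)).expectedRevenue μ ≤ c s) : m.expectedRevenue μ ≤ C := by
  have hmeas : ∀ m' : Mechanism A, Measurable m'.revenue := fun m' =>
    Finset.measurable_sum _ fun i _ => (m'.measurable_pay_apply i).coe_nnreal_ennreal
  -- Each profile is eventually untouched by the cap, so Fatou's lemma applies.
  have hlim : ∀ v, Filter.Tendsto (fun s => (m.cap hA (T s)).revenue v) Filter.atTop
      (nhds (m.revenue v)) := by
    intro v
    obtain ⟨s0, hs0⟩ := exists_nat_ge (Finset.univ.sup v)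
    refine tendsto_const_nhds.congr' ((Filter.eventually_ge_atTop s0).mono fun s hs => ?_)
    have : (fun j => min (v j) (T s)) = v := by
      funext j
      refine min_eq_left ((Finset.le_sup (f := v) (Finset.mem_univ j)).trans (hs0.trans ?_))
      exact le_trans (by exact_mod_cast hs) (hT s)
    simp only [revenue, cap, this]
  calc m.expectedRevenue μ
      = ∫⁻ v, Filter.liminf (fun s => (m.cap hA (T s)).revenue v) Filter.atTop
          ∂(Measure.pi fun _ : Fin n => μ) :=
        lintegral_congr fun v => (hlim v).liminf_eq.symm
    _ ≤ Filter.liminf (fun s => (m.cap hA (T s)).expectedRevenue μ) Filter.atTop :=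
        lintegral_liminf_le fun s => hmeas _
    _ ≤ Filter.liminf c Filter.atTop :=
        Filter.liminf_le_liminf (Filter.Eventually.of_forall h)
    _ = C := hc.liminf_eq

/-! ### The revenue from raising the highest value -/

open Classical in
/-- The mechanism for the `1`-unit environment that sells to the agent with the highest value
the additional service that she receives for having more than the second highest value. -/
def surplus (q : ℝ≥0) (hA : ∀ x ∈ A, ∀ i, 0 ≤ x i ∧ x i ≤ q) :
    Mechanism (allocations (oneUnitFeasible n)) where
  alloc v i := if WinsVickrey v i then
    (m.alloc v i - m.alloc (Function.update v i (highestOther v i)) i) / q else 0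
  pay v i := if WinsVickrey v i then
    (m.pay v i - m.pay (Function.update v i (highestOther v i)) i) / q else 0
  measurable_alloc := measurable_pi_iff.2 fun i =>
    Measurable.ite (measurableSet_winsVickrey i) (((m.measurable_alloc_apply i).sub
      ((m.measurable_alloc_apply i).comp
        (measurable_update i (measurable_highestOther i)))).div_const _) measurable_const
  measurable_pay := measurable_pi_iff.2 fun i =>
    Measurable.ite (measurableSet_winsVickrey i) (((m.measurable_pay_apply i).sub
      ((m.measurable_pay_apply i).comp
        (measurable_update i (measurable_highestOther i)))).div_const _) measurable_const
  feasible v := by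
    by_cases hw : ∃ i, WinsVickrey v i
    · obtain ⟨i, hi⟩ := hw
      -- Serve i with probability c and nobody otherwise; division by q ensures c ≤ 1, also for q =
      -- 0, where c is 0.
      set c : ℝ := (m.alloc v i - m.alloc (Function.update v i (highestOther v i)) i) / q with hc
      have h0 : 0 ≤ c := by
        have := m.slice_alloc_mono v i hi.highestOther_le
        simp only [Function.update_eq_self] at this
        exact div_nonneg (sub_nonneg.2 this) q.coe_nonneg
      have h1 : c ≤ 1 := by
        refine div_le_one_of_le₀ ?_ q.coe_nonneg
        have h2 := (hA _ (m.feasible v) i).2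
        have h3 := (hA _ (m.feasible (Function.update v i (highestOther v i))) i).1
        linarith
      have hmem := (convex_convexHull ℝ (served '' oneUnitFeasible n))
        (subset_convexHull ℝ _ ⟨{i}, by simp [oneUnitFeasible], rfl⟩)
        (subset_convexHull ℝ _ ⟨∅, by simp [oneUnitFeasible], rfl⟩) h0 (sub_nonneg.2 h1)
        (add_sub_cancel c 1)
      refine (congrArg (· ∈ convexHull ℝ (served '' oneUnitFeasible n)) ?_).mp hmem
      funext j
      by_cases hj : j = i
      · subst hj
        simp [served, hi, hc]
      · have : ¬ WinsVickrey v j := fun h => hj (h.unique hi)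
        simp [served, hj, this]
    · refine subset_convexHull ℝ _ ⟨∅, by simp [oneUnitFeasible], ?_⟩
      funext j
      have : ¬ WinsVickrey v j := fun h => hw ⟨j, h⟩
      simp [served, this]
  individuallyRational v i := by
    by_cases hi : WinsVickrey v i
    · simp only [hi, if_true]
      have h1 := m.slice_ic v i (v i) (highestOther v i)
      have h2 := m.mul_le_slice_pay_sub v i (highestOther v i) (v i)
      have h3 := m.slice_alloc_mono v i hi.highestOther_le
      simp only [Function.update_eq_self] at h1 h2 h3
      have h4 := mul_nonneg (highestOther v i).coe_nonneg (sub_nonneg.2 h3)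
      have h5 : m.pay (Function.update v i (highestOther v i)) i ≤ m.pay v i := by
        rw [← NNReal.coe_le_coe]; linarith
      rw [NNReal.coe_div, NNReal.coe_sub h5, mul_div_assoc', ← sub_div]
      exact div_nonneg (by linarith) q.coe_nonneg
    · simp [hi]
  incentiveCompatible v i z := by
    simp only [highestOther_update, Function.update_idem]
    set h := highestOther v i with hh
    -- Subtraction of payments truncates at zero; this shows that for winning reports it is the true
    -- difference.
    have hpay : ∀ a, h ≤ a → m.pay (Function.update v i h) i ≤ m.pay (Function.update v i a) i := by
      intro a ha
      have h2 := m.mul_le_slice_pay_sub v i h a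
      have h3 := m.slice_alloc_mono v i ha
      have h4 := mul_nonneg h.coe_nonneg (sub_nonneg.2 h3)
      rw [← NNReal.coe_le_coe]
      linarith
    have hrep : WinsVickrey (Function.update v i z) i → h ≤ z := fun hw => by
      have := hw.highestOther_le
      rwa [highestOther_update, Function.update_self] at this
    have h1 := m.slice_ic v i (v i) z
    have h2 := m.slice_ic v i (v i) h
    have h3 := m.slice_ic v i h z
    rw [Function.update_eq_self] at h1 h2
    by_cases hv : WinsVickrey v i
    · have hpv := hpay (v i) hv.highestOther_le
      rw [Function.update_eq_self] at hpv
      simp only [hv, if_true]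
      by_cases hz : WinsVickrey (Function.update v i z) i
      · simp only [hz, if_true]
        rw [NNReal.coe_div, NNReal.coe_div, NNReal.coe_sub hpv, NNReal.coe_sub (hpay z (hrep hz)),
          mul_div_assoc', ← sub_div, mul_div_assoc', ← sub_div]
        exact div_le_div_of_nonneg_right (by linarith) q.coe_nonneg
      · simp only [hz, if_false]
        rw [NNReal.coe_div, NNReal.coe_sub hpv, mul_div_assoc', ← sub_div, mul_zero,
          NNReal.coe_zero, sub_zero]
        exact div_nonneg (by linarith) q.coe_nonneg
    · simp only [hv, if_false]
      by_cases hz : WinsVickrey (Function.update v i z) i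
      · simp only [hz, if_true]
        rw [NNReal.coe_div, NNReal.coe_sub (hpay z (hrep hz)), mul_div_assoc', ← sub_div, mul_zero,
          NNReal.coe_zero, sub_zero]
        refine div_nonpos_of_nonpos_of_nonneg ?_ q.coe_nonneg
        -- A loser's value is at most h, while extra service above the report h costs at least h per
        -- unit.
        have h4 : (v i : ℝ) ≤ h := by exact_mod_cast le_highestOther_of_not_winsVickrey hv
        have h5 := mul_le_mul_of_nonneg_right h4 (sub_nonneg.2 (m.slice_alloc_mono v i (hrep hz)))
        simp only at h5
        linarith
      · simp [hz]

/-- The revenue of a mechanism exceeds the revenue for the second highest value by at most the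
optimal revenue of the `1`-unit environment. -/
lemma expectedRevenue_le_add_optRevenue (μ : Measure ℝ≥0) [IsProbabilityMeasure μ] (q : ℝ≥0)
    (hA : ∀ x ∈ A, ∀ i, 0 ≤ x i ∧ x i ≤ q) :
    m.expectedRevenue μ ≤
      ∫⁻ v, ∑ i, (m.pay (Function.update v i (lowerHighest v i)) i : ℝ≥0∞)
        ∂(Measure.pi fun _ : Fin n => μ)
      + q * optRevenue (allocations (oneUnitFeasible n)) μ := by
  have key : ∀ v, m.revenue v ≤
      ∑ i, (m.pay (Function.update v i (lowerHighest v i)) i : ℝ≥0∞)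
        + q * (m.surplus q hA).revenue v := by
    intro v
    simp only [revenue, Finset.mul_sum, ← Finset.sum_add_distrib]
    refine Finset.sum_le_sum fun i _ => ?_
    rw [← ENNReal.coe_mul, ← ENNReal.coe_add, ENNReal.coe_le_coe]
    by_cases hi : WinsVickrey v i
    · simp only [surplus, hi, if_true, lowerHighest, min_eq_right hi.highestOther_le]
      -- If q = 0 nobody is ever served, and individual rationality leaves no revenue.
      rcases eq_or_ne q 0 with hq | hq
      · have h1 := m.individuallyRational v i
        have h2 : m.alloc v i ≤ 0 := by
          simpa [hq] using (hA _ (m.feasible v) i).2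
        have h3 := mul_nonneg (v i).coe_nonneg (sub_nonneg.2 h2)
        have h4 : (m.pay v i : ℝ) ≤ 0 := by linarith
        have h5 : m.pay v i ≤ 0 := by exact_mod_cast h4
        exact h5.trans zero_le
      · rw [mul_div_cancel₀ _ hq]
        exact le_add_tsub
    · have : lowerHighest v i = v i := min_eq_left (le_highestOther_of_not_winsVickrey hi)
      rw [this, Function.update_eq_self]
      exact le_self_add
  calc m.expectedRevenue μ
      ≤ ∫⁻ v, (∑ i, (m.pay (Function.update v i (lowerHighest v i)) i : ℝ≥0∞)
        + q * (m.surplus q hA).revenue v) ∂(Measure.pi fun _ : Fin n => μ) := lintegral_mono key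
    _ = ∫⁻ v, ∑ i, (m.pay (Function.update v i (lowerHighest v i)) i : ℝ≥0∞)
        ∂(Measure.pi fun _ : Fin n => μ) + q * (m.surplus q hA).expectedRevenue μ := by
        rw [lintegral_add_left, lintegral_const_mul' _ _ ENNReal.coe_ne_top, expectedRevenue]
        refine Finset.measurable_sum _ fun i _ => Measurable.coe_nnreal_ennreal ?_
        exact (m.measurable_pay_apply i).comp (measurable_update i
          ((measurable_pi_apply i).min (measurable_highestOther i)))
    _ ≤ _ := by
        gcongr
        exact le_iSup (fun m' : Mechanism (allocations (oneUnitFeasible n)) =>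
          m'.expectedRevenue μ) (m.surplus q hA)

end Mechanism

/-- Redrawing one coordinate preserves the product law: the inner integral no longer depends on it,
and integrating over it again contributes mass one. -/
lemma lintegral_pi_update (μ : Measure ℝ≥0) [IsProbabilityMeasure μ] (i : Fin n)
    {f : (Fin n → ℝ≥0) → ℝ≥0∞} (hf : Measurable f) :
    ∫⁻ v, f v ∂(Measure.pi fun _ : Fin n => μ) =
      ∫⁻ v, ∫⁻ z, f (Function.update v i z) ∂μ ∂(Measure.pi fun _ : Fin n => μ) := by
  have h1 : ∀ g : (Fin n → ℝ≥0) → ℝ≥0∞, ∫⁻ v, g v ∂(Measure.pi fun _ : Fin n => μ) =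
      lmarginal (fun _ : Fin n => μ) Finset.univ g 0 := fun g => by
    rw [lintegral_eq_lmarginal_univ (0 : Fin n → ℝ≥0)]
  have h2 : ∀ g : (Fin n → ℝ≥0) → ℝ≥0∞, Measurable g →
      lmarginal (fun _ : Fin n => μ) Finset.univ g =
        lmarginal (fun _ : Fin n => μ) (Finset.univ.erase i)
          fun v => ∫⁻ z, g (Function.update v i z) ∂μ := fun g hg =>
    lmarginal_erase' g hg (Finset.mem_univ i)
  have hm : Measurable fun v => ∫⁻ z, f (Function.update v i z) ∂μ := by
    have := hf.lmarginal (fun _ : Fin n => μ) (s := {i})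
    rwa [lmarginal_singleton] at this
  rw [h1, h1, h2 f hf, h2 _ hm]
  simp

lemma avgRank_one_le (M : Matroid (Fin n)) : avgRank M 1 ≤ 1 := by
  have hcard : ∀ S : Finset (Fin n), matroidRank M S ≤ S.card := fun S => by
    have := M.eRk_le_encard S
    rw [← coe_matroidRank, Set.encard_coe_eq_coe_finsetCard] at this
    exact_mod_cast this
  have h1 : (firstAgents n 1).card ≤ 1 := Finset.card_le_one.2 fun a ha b hb => by
    rw [mem_firstAgents] at ha hb
    exact Fin.ext (by omega)
  rw [avgRank, div_le_one (by positivity)]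
  calc ∑ π : Equiv.Perm (Fin n), (matroidRank M ((firstAgents n 1).map π.toEmbedding) : ℝ)
      ≤ ∑ _π : Equiv.Perm (Fin n), (1 : ℝ) := Finset.sum_le_sum fun π _ => by
        have := hcard ((firstAgents n 1).map π.toEmbedding)
        rw [Finset.card_map] at this
        exact_mod_cast this.trans h1
    _ = (n.factorial : ℝ) := by simp [Finset.card_univ, Fintype.card_perm]

lemma avgRank_one_nonneg (M : Matroid (Fin n)) : 0 ≤ avgRank M 1 := by
  have := posWeight_nonneg M 0
  rwa [posWeight, avgRank_zero, sub_zero] at this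

/-! ### The greedy mechanism for virtual values -/

section GridMechanism

variable (M : Matroid (Fin n)) {N : ℕ} {ε : ℝ} (y : Fin (N + 1) → ℝ)

/-- The service probability of agent `i` as a function of her own cell. -/
def ownCurve (k : Fin n → Fin (N + 1)) (i : Fin n) (j : Fin (N + 1)) : ℝ :=
  greedyAlloc M (Function.update (fun l => y (k l)) i (y j)) i

variable {y}

lemma ownCurve_mono (hy : Monotone y) (k : Fin n → Fin (N + 1)) (i : Fin n) :
    Monotone (ownCurve M y k i) := by
  intro j j' h
  refine greedyAlloc_le_of_others_le M (by simpa using hy h) fun l hl => ?_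
  simp [Function.update_of_ne hl]

variable (y)

lemma ownCurve_nonneg (k : Fin n → Fin (N + 1)) (i : Fin n) (j : Fin (N + 1)) :
    0 ≤ ownCurve M y k i j := greedyAlloc_nonneg M _ i

lemma ownCurve_self (k : Fin n → Fin (N + 1)) (i : Fin n) :
    ownCurve M y k i (k i) = greedyAlloc M (fun l => y (k l)) i := by
  rw [ownCurve, Function.update_eq_self_iff.2 rfl]

/-- The curve offered to an agent ignores her own report, which reduces truthfulness to
`stepPay_incentive`. -/
lemma ownCurve_update (k : Fin n → Fin (N + 1)) (i : Fin n) (l : Fin (N + 1)) :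
    ownCurve M y (Function.update k i l) i = ownCurve M y k i := by
  funext j
  unfold ownCurve
  congr 1
  funext a
  rcases eq_or_ne a i with rfl | h
  · simp
  · simp [Function.update_of_ne h]

/-- The cells of a profile. -/
def cells (ε : ℝ) (N : ℕ) (v : Fin n → ℝ≥0) : Fin n → Fin (N + 1) := fun i => cell ε N (v i)

lemma cells_update (v : Fin n → ℝ≥0) (i : Fin n) (z : ℝ≥0) :
    cells ε N (Function.update v i z) = Function.update (cells ε N v) i (cell ε N z) := by
  funext a
  rcases eq_or_ne a i with rfl | h
  · simp [cells]
  · simp [cells, Function.update_of_ne h]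

lemma measurable_cells (ε : ℝ) (N : ℕ) : Measurable (cells (n := n) ε N) :=
  measurable_pi_iff.2 fun i => (measurable_cell ε N).comp (measurable_pi_apply i)

variable {y}

/-- The mechanism that serves the agents greedily by the virtual values `y` of their cells. -/
def gridMechanism (hε : 0 < ε) (hy : Monotone y) :
    Mechanism (permAllocations (matroidFeasible M)) where
  alloc v := greedyAlloc M fun l => y (cells ε N v l)
  pay v i := Real.toNNReal (stepPay ε (ownCurve M y (cells ε N v) i) (cells ε N v i))
  measurable_alloc :=
    (measurable_of_countable fun k : Fin n → Fin (N + 1) => greedyAlloc M fun l => y (k l)).comp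
      (measurable_cells ε N)
  measurable_pay :=
    (measurable_of_countable fun (k : Fin n → Fin (N + 1)) (i : Fin n) =>
      Real.toNNReal (stepPay ε (ownCurve M y k i) (k i))).comp (measurable_cells ε N)
  feasible v := greedyAlloc_mem M _
  individuallyRational v i := by
    rw [Real.coe_toNNReal _ (stepPay_nonneg hε.le (ownCurve_mono M hy _ i) _),
      ← ownCurve_self M y (cells ε N v) i]
    exact sub_nonneg.2 (stepPay_le_mul hε (ownCurve_nonneg M y _ i) (v i))
  incentiveCompatible v i z := by
    rw [Real.coe_toNNReal _ (stepPay_nonneg hε.le (ownCurve_mono M hy _ i) _),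
      Real.coe_toNNReal _ (stepPay_nonneg hε.le (ownCurve_mono M hy _ i) _),
      ← ownCurve_self M y (cells ε N v) i,
      ← ownCurve_self M y (cells ε N (Function.update v i z)) i, cells_update, ownCurve_update,
      Function.update_self]
    exact stepPay_incentive hε (ownCurve_mono M hy _ i) (v i) _

lemma gridMechanism_pay_update (hε : 0 < ε) (hy : Monotone y) (v : Fin n → ℝ≥0) (i : Fin n)
    (z : ℝ≥0) : (gridMechanism M hε hy).pay (Function.update v i z) i =
      Real.toNNReal (stepPay ε (ownCurve M y (cells ε N v) i) (cell ε N z)) := by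
  simp only [gridMechanism, cells_update, ownCurve_update, Function.update_self]

lemma le_EFO {A : Set (Fin n → ℝ)} {v : Fin n → ℝ≥0} {x : Fin n → ℝ} {p : Fin n → ℝ≥0} (hx : x ∈ A)
    (hef : EnvyFree v x p) (hir : IndividuallyRational v x p) :
    ∑ i, (p i : ℝ≥0∞) ≤ EFO A v :=
  le_iSup_of_le x (le_iSup_of_le p (le_iSup_of_le hx (le_iSup_of_le hef (le_iSup_of_le hir le_rfl))))

lemma lowerHighest_le (v : Fin n → ℝ≥0) (i : Fin n) : lowerHighest v i ≤ v i := min_le_left _ _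

lemma le_highestOther (v : Fin n → ℝ≥0) {i j : Fin n} (h : j ≠ i) : v j ≤ highestOther v i :=
  Finset.le_sup (f := v) (Finset.mem_erase.2 ⟨h, Finset.mem_univ j⟩)

/-- An agent whose value is lowered still has the highest value. -/
lemma lowerHighest_eq_or_le (v : Fin n → ℝ≥0) {i j : Fin n} (h : j ≠ i) :
    lowerHighest v j = v j ∨ lowerHighest v i ≤ lowerHighest v j := by
  rcases le_total (v j) (highestOther v j) with h' | h'
  · exact Or.inl (min_eq_left h')
  · right
    rw [show lowerHighest v j = highestOther v j from min_eq_right h']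
    exact (lowerHighest_le v i).trans (le_highestOther v h.symm)

/-- The payments of the greedy mechanism for the second highest value are at most those of an
envy-free outcome. -/
lemma sum_gridMechanism_pay_le (hε : 0 < ε) (hy : Monotone y) (v : Fin n → ℝ≥0) :
    ∑ i, ((gridMechanism M hε hy).pay (Function.update v i (lowerHighest v i)) i : ℝ≥0∞) ≤
      EFO2 (permAllocations (matroidFeasible M)) v := by
  set w := lowerHighest v with hw
  set W : Fin n → ℝ := fun i => y (cells ε N w i) with hW
  set Y : Fin n → ℝ := fun i => y (cells ε N v i) with hY
  have hcm : Monotone (cell ε N) := cell_mono hε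
  have hWY : ∀ i, W i ≤ Y i := fun i => hy (hcm (lowerHighest_le v i))
  let g : Fin n → ℝ≥0 := fun i => ⟨greedyAlloc M W i, greedyAlloc_nonneg M W i⟩
  -- All agents face this one curve, so its step payments are envy free. The running maximum makes
  -- it monotone and defines it on cells without agents.
  let X : Fin (N + 1) → ℝ := fun j =>
    ((Finset.univ.filter fun i => cells ε N w i ≤ j).sup g : ℝ≥0)
  have hX : Monotone X := fun j j' h => NNReal.coe_le_coe.2 (Finset.sup_mono fun i hi => by
    rw [Finset.mem_filter] at hi ⊢
    exact ⟨hi.1, hi.2.trans h⟩)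
  have hX0 : ∀ j, 0 ≤ X j := fun j => NNReal.coe_nonneg _
  have hXi : ∀ i, X (cells ε N w i) = greedyAlloc M W i := by
    intro i
    have : (Finset.univ.filter fun l => cells ε N w l ≤ cells ε N w i).sup g = g i :=
      le_antisymm (Finset.sup_le fun l hl =>
          greedyAlloc_mono M (hy (Finset.mem_filter.1 hl).2))
        (Finset.le_sup (Finset.mem_filter.2 ⟨Finset.mem_univ i, le_rfl⟩))
    exact congrArg NNReal.toReal this
  have hcoe : ∀ i, ((Real.toNNReal (stepPay ε X (cells ε N w i)) : ℝ≥0) : ℝ) =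
      stepPay ε X (cells ε N w i) := fun i => Real.coe_toNNReal _ (stepPay_nonneg hε.le hX _)
  have hfeas := le_EFO (v := w) (p := fun i => Real.toNNReal (stepPay ε X (cells ε N w i)))
    (greedyAlloc_mem M W)
    (fun i j => by
      rw [hcoe, hcoe, ← hXi, ← hXi]
      exact stepPay_incentive hε hX (w i) _)
    (fun i => by
      rw [hcoe, ← hXi]
      exact sub_nonneg.2 (stepPay_le_mul hε hX0 (w i)))
  refine (Finset.sum_le_sum fun i _ => ?_).trans hfeas
  rw [ENNReal.coe_le_coe, gridMechanism_pay_update]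
  refine Real.toNNReal_le_toNNReal (stepPay_mono_of_sub_le hε.le fun j hj => ?_)
  change ownCurve M y (cells ε N v) i (cells ε N w i) - _ ≤ X (cells ε N w i) - _
  change j < cells ε N w i at hj
  -- Payments are compared increment by increment. Where y is flat the own curve is flat too;
  -- otherwise it lies below X at the agent's lowered cell and above X at j.
  rcases (hy hj.le).eq_or_lt with heq | hlt
  · have : ownCurve M y (cells ε N v) i (cells ε N w i) = ownCurve M y (cells ε N v) i j := by
      simp only [ownCurve, heq]
    rw [this, sub_self]
    exact sub_nonneg.2 (hX hj.le)
  change y j < W i at hlt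
  refine sub_le_sub ?_ ?_
  · rw [hXi]
    refine greedyAlloc_le_of_others_le M (by simp [hW]) fun l hl => ?_
    rw [Function.update_of_ne hl]
    exact hWY l
  · rw [← Real.coe_toNNReal _ (ownCurve_nonneg M y (cells ε N v) i j)]
    refine NNReal.coe_le_coe.2 (Finset.sup_le fun l hl => ?_)
    have hWl : W l ≤ y j := hy (Finset.mem_filter.1 hl).2
    rw [← NNReal.coe_le_coe, Real.coe_toNNReal _ (ownCurve_nonneg M y (cells ε N v) i j)]
    change greedyAlloc M W l ≤ greedyAlloc M (Function.update Y i (y j)) i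
    -- An agent other than i whose value was lowered still weighs at least as much as i, hence more
    -- than l. She is counted ahead of l after the lowering, so the counts can be compared.
    have hcases : ∀ m, m ≠ i → W m = Y m ∨ W l < W m := by
      intro m hm
      rcases lowerHighest_eq_or_le v hm with h | h
      · left
        simp only [hW, hY, cells, hw, h]
      · right
        exact (hWl.trans_lt hlt).trans_le (hy (hcm h))
    refine greedyAlloc_le_greedyAlloc M (fun h => ?_) ?_ ?_
    · rw [Function.update_self]
      exact h.trans_le hWl
    · refine Finset.card_le_card fun m hm => ?_
      simp only [Finset.mem_filter, Finset.mem_univ, true_and, Function.update_self] at hm ⊢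
      rcases eq_or_ne m i with rfl | hne
      · simp at hm
      · rw [Function.update_of_ne hne] at hm
        rcases hcases m hne with h | h
        · rw [h]; exact hWl.trans_lt hm
        · exact h
    · refine Finset.card_le_card fun m hm => ?_
      simp only [Finset.mem_filter, Finset.mem_univ, true_and, Function.update_self] at hm ⊢
      rcases eq_or_ne m i with rfl | hne
      · exact (hWl.trans_lt hlt).le
      · rw [Function.update_of_ne hne] at hm
        rcases hcases m hne with h | h
        · rw [h]; exact hWl.trans hm
        · exact h.le

/-- Selling at the second highest value to the agents with the highest value is envy free. -/
lemma mul_vickrey_revenue_le (v : Fin n → ℝ≥0) :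
    ENNReal.ofReal (avgRank M 1) * (vickrey n).revenue v ≤
      EFO2 (permAllocations (matroidFeasible M)) v := by
  classical
  by_cases hw : ∃ i, WinsVickrey v i
  swap
  · have : (vickrey n).revenue v = 0 := by
      refine Finset.sum_eq_zero fun i _ => ?_
      have : ¬ WinsVickrey v i := fun h => hw ⟨i, h⟩
      simp [vickrey, this]
    simp [this]
  obtain ⟨i, hi⟩ := hw
  set z := highestOther v i with hz
  set w := lowerHighest v with hwdef
  have hwi : w i = z := min_eq_right hi.highestOther_le
  have hwz : ∀ k, w k ≤ z := by
    intro k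
    rcases eq_or_ne k i with rfl | hk
    · exact hwi.le
    · exact (lowerHighest_le v k).trans (le_highestOther v hk)
  have hrev : (vickrey n).revenue v = z := by
    unfold Mechanism.revenue
    rw [Finset.sum_eq_single i]
    · simp [vickrey, hi, hz]
    · intro j _ hj
      have : ¬ WinsVickrey v j := fun h => hj (h.unique hi)
      simp [vickrey, this]
    · simp
  -- Serve only the agents at the top value z of the lowered profile, at price z per unit. Truthful
  -- utilities vanish, and nobody values service above z.
  set ω : Fin n → ℝ := fun k => if w k = z then 1 else 0 with hω
  have hω0 : ∀ k, 0 ≤ ω k := fun k => by simp only [hω]; split_ifs <;> norm_num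
  have hg0 := greedyAlloc_nonneg M ω
  let p : Fin n → ℝ≥0 := fun k => if w k = z then z * Real.toNNReal (greedyAlloc M ω k) else 0
  have hutil : ∀ k j, (w k : ℝ) * greedyAlloc M ω j - p j ≤ 0 := by
    intro k j
    by_cases hj : w j = z
    · simp only [p, hj, if_true, NNReal.coe_mul, Real.coe_toNNReal _ (hg0 j)]
      have : (w k : ℝ) ≤ z := by exact_mod_cast hwz k
      exact sub_nonpos.2 (mul_le_mul_of_nonneg_right this (hg0 j))
    · simp [p, hj, greedyAlloc, hω]
  have hown : ∀ k, (w k : ℝ) * greedyAlloc M ω k - p k = 0 := by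
    intro k
    by_cases hk : w k = z
    · simp [p, hk, Real.coe_toNNReal _ (hg0 k)]
    · simp [p, hk, greedyAlloc, hω]
  have hle := le_EFO (v := w) (p := p) (greedyAlloc_mem M ω)
    (fun k j => by rw [hown k]; exact hutil k j) (fun k => (hown k).ge)
  refine le_trans ?_ hle
  have hn : 0 < n := i.pos
  -- Giving agent i the first position and serving her alone is feasible and already yields total
  -- weight `avgRank M 1`.
  have hone : avgRank M 1 ≤ ∑ k, ω k * greedyAlloc M ω k := by
    have hmem := comp_perm_mem (posWeight_mem (M := M) {⟨0, hn⟩}) (Equiv.swap ⟨0, hn⟩ i)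
    refine le_trans ?_ (sum_mul_le_sum_mul_greedyAlloc M hω0 hmem)
    have h1 := Finset.single_le_sum (f := fun k => ω k *
      ((fun k : Fin n => if k ∈ ({⟨0, hn⟩} : Finset (Fin n)) then posWeight M k.val else 0) ∘
        (Equiv.swap ⟨0, hn⟩ i)) k)
      (fun k _ => mul_nonneg (hω0 k) (permAllocations_nonneg hmem k)) (Finset.mem_univ i)
    refine le_trans (le_of_eq ?_) h1
    simp [hω, hwi, posWeight, avgRank_zero]
  have hsum : ∑ k, (p k : ℝ≥0∞) =
      ENNReal.ofReal (∑ k, ω k * greedyAlloc M ω k) * z := by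
    rw [ENNReal.ofReal_sum_of_nonneg fun k _ => mul_nonneg (hω0 k) (hg0 k), Finset.sum_mul]
    refine Finset.sum_congr rfl fun k _ => ?_
    by_cases hk : w k = z
    · simp only [p, hω, hk, if_true, one_mul, ENNReal.coe_mul, ENNReal.ofReal]
      rw [mul_comm]
    · simp [p, hω, hk]
  rw [hsum, hrev]
  gcongr

end GridMechanism

/-! ### The Bayesian optimal revenue -/

section Bayes

variable {N : ℕ} {ε : ℝ} (μ : Measure ℝ≥0) [IsProbabilityMeasure μ]

lemma exists_virtualValue_lintegral (hε : 0 < ε) (N : ℕ) :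
    ∃ y : Fin (N + 1) → ℝ, Monotone y ∧ (∀ k, 0 ≤ y k) ∧
      (∀ x p : ℝ≥0 → ℝ, CappedMenu x p (gridPoint ε N) →
        ∫⁻ v, ENNReal.ofReal (p v) ∂μ ≤
          ENNReal.ofReal (3 * ε) + ∫⁻ v, ENNReal.ofReal (y (cell ε N v) * x v) ∂μ) ∧
      ∀ X : Fin (N + 1) → ℝ, Monotone X → (∀ k, 0 ≤ X k) → (∀ j k, y j = y k → X j = X k) →
        (∀ j, y j = 0 → X j = 0) →
        ∫⁻ v, ENNReal.ofReal (y (cell ε N v) * X (cell ε N v)) ∂μ ≤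
          ∫⁻ v, ENNReal.ofReal (stepPay ε X (cell ε N v)) ∂μ := by
  obtain ⟨y, hy, hy0, h1, h2⟩ := exists_virtualValue μ hε N
  refine ⟨y, hy, hy0, fun x p h => ?_, fun X hX hX0 hXc hXz => ?_⟩
  · have hi : Integrable (fun v => y (cell ε N v) * x v) μ := by
      refine (h.integrable_x μ).bdd_mul (c := ∑ k, ‖y k‖)
        (integrable_comp_cell μ y).aestronglyMeasurable (Filter.Eventually.of_forall fun v => ?_)
      exact Finset.single_le_sum (f := fun k => ‖y k‖) (fun _ _ => norm_nonneg _)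
        (Finset.mem_univ (cell ε N v))
    have hnn : ∀ v, 0 ≤ y (cell ε N v) * x v := fun v => mul_nonneg (hy0 _) (h.x_nonneg v)
    rw [← ofReal_integral_eq_lintegral_ofReal (h.integrable_p μ)
      (Filter.Eventually.of_forall h.p_nonneg),
      ← ofReal_integral_eq_lintegral_ofReal hi (Filter.Eventually.of_forall hnn),
      ← ENNReal.ofReal_add (by positivity) (integral_nonneg hnn)]
    exact ENNReal.ofReal_le_ofReal (h1 x p h)
  · rw [← ofReal_integral_eq_lintegral_ofReal (integrable_comp_cell μ fun k => y k * X k)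
      (Filter.Eventually.of_forall fun v => mul_nonneg (hy0 _) (hX0 _)),
      ← ofReal_integral_eq_lintegral_ofReal (integrable_comp_cell μ (stepPay ε X))
      (Filter.Eventually.of_forall fun v => stepPay_nonneg hε.le hX _)]
    exact ENNReal.ofReal_le_ofReal (h2 X hX hX0 hXc hXz)

lemma permAllocations_le_one {M : Matroid (Fin n)} {x : Fin n → ℝ}
    (hx : x ∈ permAllocations (matroidFeasible M)) (i : Fin n) : x i ≤ 1 :=
  (le_avgRank_one hx i).trans (avgRank_one_le M)

/-- Up to a small error, a greedy mechanism for virtual values is optimal among the mechanisms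
that ignore the differences of high values. -/
lemma exists_gridMechanism (M : Matroid (Fin n)) (hε : 0 < ε) (N : ℕ) :
    ∃ (y : Fin (N + 1) → ℝ) (hy : Monotone y),
      ∀ m : Mechanism (permAllocations (matroidFeasible M)),
        (m.cap (fun _ hx => permAllocations_nonneg hx) (gridPoint ε N)).expectedRevenue μ ≤
          n * ENNReal.ofReal (3 * ε) + (gridMechanism M hε hy).expectedRevenue μ := by
  obtain ⟨y, hy, hy0, hup, hlow⟩ := exists_virtualValue_lintegral μ hε N
  refine ⟨y, hy, fun m => ?_⟩
  set m' := m.cap (fun _ hx => permAllocations_nonneg hx) (gridPoint ε N) with hm'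
  set P := Measure.pi fun _ : Fin n => μ with hP
  have hymeas : ∀ i, Measurable fun v : Fin n → ℝ≥0 => y (cells ε N v i) := fun i =>
    (measurable_of_countable fun k : Fin n → Fin (N + 1) => y (k i)).comp (measurable_cells ε N)
  have hsplit : ∀ m'' : Mechanism (permAllocations (matroidFeasible M)),
      m''.expectedRevenue μ = ∑ i, ∫⁻ v, ∫⁻ z, (m''.pay (Function.update v i z) i : ℝ≥0∞) ∂μ ∂P := by
    intro m''
    simp only [Mechanism.expectedRevenue, Mechanism.revenue]
    rw [lintegral_finsetSum _ fun i _ => (m''.measurable_pay_apply i).coe_nnreal_ennreal]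
    exact Finset.sum_congr rfl fun i _ =>
      lintegral_pi_update μ i (m''.measurable_pay_apply i).coe_nnreal_ennreal
  have hvs : ∀ m'' : Mechanism (permAllocations (matroidFeasible M)), ∀ i,
      Measurable fun v => ENNReal.ofReal (y (cells ε N v i) * m''.alloc v i) := fun m'' i =>
    ((hymeas i).mul (m''.measurable_alloc_apply i)).ennreal_ofReal
  have hcell : ∀ (v : Fin n → ℝ≥0) i z, cells ε N (Function.update v i z) i = cell ε N z := by
    intro v i z
    rw [cells_update, Function.update_self]
  calc m'.expectedRevenue μ
      = ∑ i, ∫⁻ v, ∫⁻ z, (m'.pay (Function.update v i z) i : ℝ≥0∞) ∂μ ∂P := hsplit m'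
    _ ≤ ∑ i, ∫⁻ v, (ENNReal.ofReal (3 * ε) + ∫⁻ z, ENNReal.ofReal
          (y (cells ε N (Function.update v i z) i) *
            m'.alloc (Function.update v i z) i) ∂μ) ∂P := by
        refine Finset.sum_le_sum fun i _ => lintegral_mono fun v => ?_
        have h := hup _ _ (m.cappedMenu_cap (fun _ hx => permAllocations_nonneg hx)
          (fun _ hx => permAllocations_le_one hx) (gridPoint ε N) v i)
        simp only [hcell]
        simpa only [ENNReal.ofReal_coe_nnreal] using h
    _ = n * ENNReal.ofReal (3 * ε) +
          ∑ i, ∫⁻ v, ENNReal.ofReal (y (cells ε N v i) * m'.alloc v i) ∂P := by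
        simp_rw [lintegral_add_left measurable_const, lintegral_const, hP, measure_univ, mul_one,
          ← lintegral_pi_update μ _ (hvs m' _)]
        rw [Finset.sum_add_distrib, Finset.sum_const, Finset.card_univ, Fintype.card_fin,
          nsmul_eq_mul]
    _ ≤ n * ENNReal.ofReal (3 * ε) + ∑ i, ∫⁻ v, ENNReal.ofReal
          (y (cells ε N v i) * (gridMechanism M hε hy).alloc v i) ∂P := by
        refine add_le_add le_rfl ?_
        rw [← lintegral_finsetSum _ fun i _ => hvs m' i, ← lintegral_finsetSum _ fun i _ => hvs _ i]
        refine lintegral_mono fun v => ?_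
        simp only
        rw [← ENNReal.ofReal_sum_of_nonneg fun i _ =>
            mul_nonneg (hy0 _) (permAllocations_nonneg (m'.feasible v) i),
          ← ENNReal.ofReal_sum_of_nonneg fun i _ =>
            mul_nonneg (hy0 _) (permAllocations_nonneg (Mechanism.feasible _ v) i)]
        exact ENNReal.ofReal_le_ofReal (sum_mul_le_sum_mul_greedyAlloc M
          (w := fun i => y (cells ε N v i)) (fun i => hy0 _) (m'.feasible v))
    _ ≤ n * ENNReal.ofReal (3 * ε) + (gridMechanism M hε hy).expectedRevenue μ := by
        gcongr
        rw [hsplit]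
        refine Finset.sum_le_sum fun i _ => ?_
        rw [hP, lintegral_pi_update μ i (hvs _ i)]
        refine lintegral_mono fun v => ?_
        simp only [hcell, gridMechanism_pay_update]
        -- The own curve depends on a cell only through its virtual value and is zero where that is
        -- zero, so ironing is lossless for it.
        have h := hlow (ownCurve M y (cells ε N v) i) (ownCurve_mono M hy _ i)
          (ownCurve_nonneg M y _ i) (fun j k hjk => by simp only [ownCurve, hjk])
          (fun j hj => by simp [ownCurve, greedyAlloc, hj])
        refine le_trans (lintegral_mono fun z => ?_) h
        have : (gridMechanism M hε hy).alloc (Function.update v i z) i =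
            ownCurve M y (cells ε N v) i (cell ε N z) := by
          have h1 := ownCurve_self M y (cells ε N (Function.update v i z)) i
          rw [hcell, cells_update, ownCurve_update] at h1
          rw [h1, ← cells_update]
          rfl
        rw [this]

/-- For a tail-regular distribution the Bayesian optimal revenue is at most three times the
expected envy-free benchmark. -/
lemma optRevenue_le_lintegral_EFO2 (M : Matroid (Fin n)) (hμ : TailRegular n μ) :
    optRevenue (permAllocations (matroidFeasible M)) μ ≤
      3 * ∫⁻ v, EFO2 (permAllocations (matroidFeasible M)) v ∂(Measure.pi fun _ : Fin n => μ) := by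
  set P := Measure.pi fun _ : Fin n => μ with hP
  set I := ∫⁻ v, EFO2 (permAllocations (matroidFeasible M)) v ∂P with hI
  set q : ℝ≥0 := Real.toNNReal (avgRank M 1) with hq
  have hqc : (q : ℝ) = avgRank M 1 := Real.coe_toNNReal _ (avgRank_one_nonneg M)
  have hgrid : ∀ (N : ℕ) (ε : ℝ) (hε : 0 < ε) (y : Fin (N + 1) → ℝ) (hy : Monotone y),
      (gridMechanism M hε hy).expectedRevenue μ ≤ 3 * I := by
    intro N ε hε y hy
    have h1 := (gridMechanism M hε hy).expectedRevenue_le_add_optRevenue μ q fun x hx i =>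
      ⟨permAllocations_nonneg hx i, by rw [hqc]; exact le_avgRank_one hx i⟩
    have h2 : (q : ℝ≥0∞) * optRevenue (allocations (oneUnitFeasible n)) μ ≤ 2 * I := by
      calc (q : ℝ≥0∞) * optRevenue (allocations (oneUnitFeasible n)) μ
          ≤ q * (2 * (vickrey n).expectedRevenue μ) := by gcongr; exact hμ
        _ = 2 * ∫⁻ v, q * (vickrey n).revenue v ∂P := by
            rw [lintegral_const_mul' _ _ ENNReal.coe_ne_top, Mechanism.expectedRevenue,
              mul_left_comm]
        _ ≤ 2 * I := by
            exact mul_le_mul_right (lintegral_mono fun v => mul_vickrey_revenue_le M v) 2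
    calc (gridMechanism M hε hy).expectedRevenue μ ≤ I + 2 * I :=
          h1.trans (add_le_add (lintegral_mono fun v => sum_gridMechanism_pay_le M hε hy v) h2)
      _ = 3 * I := by ring
  refine iSup_le fun m => ?_
  have hpos : ∀ s : ℕ, (0 : ℝ) < 1 / ((s : ℝ) + 1) := fun s => by positivity
  -- Width 1 / (s + 1) and (s + 1)² cells put the cap at s + 1, while the error, proportional to n /
  -- (s + 1), vanishes.
  refine m.expectedRevenue_le_of_cap (fun _ hx => permAllocations_nonneg hx) μ
    (T := fun s => gridPoint (1 / ((s : ℝ) + 1)) ((s + 1) ^ 2))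
    (c := fun s : ℕ => n * ENNReal.ofReal (3 * (1 / ((s : ℝ) + 1))) + 3 * I)
    (fun s => ?_) ?_ fun s => ?_
  · rw [← NNReal.coe_le_coe, coe_gridPoint (hpos s)]
    push_cast
    field_simp
    linarith
  · have h1 : Filter.Tendsto (fun s : ℕ => ENNReal.ofReal (3 * (1 / ((s : ℝ) + 1))))
        Filter.atTop (nhds 0) := by
      have := (tendsto_one_div_add_atTop_nhds_zero_nat (𝕜 := ℝ)).const_mul 3
      rw [mul_zero] at this
      simpa using ENNReal.tendsto_ofReal this
    have h2 := (ENNReal.Tendsto.const_mul (a := (n : ℝ≥0∞)) h1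
      (Or.inr (ENNReal.natCast_ne_top n))).add (tendsto_const_nhds (x := 3 * I))
    simpa using h2
  · obtain ⟨y, hy, h⟩ := exists_gridMechanism μ M (hpos s) ((s + 1) ^ 2)
    exact (h m).trans (by gcongr; exact hgrid _ _ _ _ _)

end Bayes

end SingleDim

end

theorem theorem5p3 (n : ℕ) (hn : 2 ≤ n) (M : Matroid (Fin n))
    (μ : MeasureTheory.Measure NNReal) [MeasureTheory.IsProbabilityMeasure μ]
    (hμ : SingleDim.TailRegular n μ) (β : NNReal)
    (m : SingleDim.Mechanism (SingleDim.permAllocations (SingleDim.matroidFeasible M)))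
    (hm : SingleDim.ApproximatesEFO2 m β) :
    SingleDim.optRevenue (SingleDim.permAllocations (SingleDim.matroidFeasible M)) μ
      ≤ 3 * β * m.expectedRevenue μ := by
  refine (SingleDim.optRevenue_le_lintegral_EFO2 μ M hμ).trans ?_
  rw [mul_assoc, SingleDim.Mechanism.expectedRevenue,
    ← lintegral_const_mul' _ _ ENNReal.coe_ne_top]
  gcongr with v
  exact hm v
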